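/- Let $[n]=\{1,\dots,n\}$, and for distributions $p,q$ over $[n]$ let $\mathrm{TV}(p,q)=\max_{S\subseteq[n]}|p(S)-q(S)|$. An algorithm here is randomized, draws a fixed number of i.i.d. samples from an unknown distribution $p$ over $[n]$, and is given the descriptions of a known distribution $q$ over $[n]$ and, in the augmented case, of a prediction $\hat p$ over $[n]$; the number of samples may depend on the known data. For fixed $q$ and $\hat p$, an algorithm with answers accept, reject, inaccurate is called $(\alpha,\epsilon,\delta)$-correct for $(q,\hat p)$ if for every $p$ over $[n]$: - if $\mathrm{TV}(p,\hat p)\le\alpha$, it answers inaccurate with probability at most $\delta/2$; - if $p=q$, it answers reject with probability at most $\delta/2$; - if $\mathrm{TV}(p,q)>\epsilon$, it answers accept with probability at most $\delta/2$. It is an $(\alpha,\epsilon,\delta)$-augmented identity tester if it is $(\alpha,\epsilon,\delta)$-correct for all $q,\hat p$. A standard identity tester with error $\eta$ answers accept or reject; it rejects with probability at most $\eta$ if $p=q$, and accepts with probability at most $\eta$ if $\mathrm{TV}(p,q)>\epsilon$. Put $d=\mathrm{TV}(q,\hat p)$ and $$R(n,\alpha,\epsilon,d)=\begin{cases}\sqrt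 n/\epsilon^2 & \text{if } d\le\alpha,\\ \min\left(1/(d-\alpha)^2,\ \sqrt n/\epsilon^2\right)&\text{if } d>\alpha,\end{cases}$$ where $\sqrt n/\epsilon^2=\infty$ if $\epsilon=0$. **Algorithm** (with a constant $K>0$ and a standard identity tester $T$). If $d\le\alpha$ or $1/(d-\alpha)^2>\sqrt n/\epsilon^2$, return the answer of $T$ on $q$ and samples from $p$. Otherwise let $S=\{x:\hat p(x)<q(x)\}$, draw $m=\lceil K/(d-\alpha)^2\rceil$ samples from $p$, let $\sigma$ be the fraction of them in $S$, and answer reject if $|q(S)-\sigma|>(d-\alpha)/4$ and inaccurate otherwise. **Theorem.** 1. There are standard identity testers with error $0.05$, for all $n$ and all $\epsilon\in(0,1]$, that use at most $C\sqrt n/\epsilon^2$ samples for an absolute constant $C$. 2. There is an absolute constant $K_0>0$ such that for every $K\ge K_0$ and every $C\ge 0$ there is a constant $C'$, depending only on $K$ and $C$, for which the following holds. If $T$ is a family of testers as in 1 with constant $C$, then for all $n$, $\alpha\in[0,1]$ and $\epsilon\in(0,1]$ the Algorithm is an $(\alpha,\epsilon,0.1)$-augmented identity tester, and it uses at most $C'\,R(n,\alpha,\epsilon,d)$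 samples for all $q,\hat p$ over $[n]$. 3. The same number of samples is necessary, even when $q$ is the uniform distribution $U_n$ over $[n]$. For every $\delta\in(0,2/3)$ there is a constant $c>0$, depending only on $\delta$, such that for all $n\ge1$, $\alpha\in[0,1]$ and $\epsilon\in[0,1/2]$ with $\epsilon<1-1/n$: - for every $\hat p$ over $[n]$ with $d=\mathrm{TV}(U_n,\hat p)\le\alpha$, every algorithm that is $(\alpha,\epsilon,\delta)$-correct for $(U_n,\hat p)$ uses at least $c\,R(n,\alpha,\epsilon,d)$ samples; - for every real $d$ with $\alpha<d\le 1/2$ there is $\hat p$ over $[n]$ with $\mathrm{TV}(U_n,\hat p)=d$ such that every algorithm that is $(\alpha,\epsilon,\delta)$-correct for $(U_n,\hat p)$ uses at least $c\,R(n,\alpha,\epsilon,d)$ samples. In particular, these bounds hold for the number of samples that any $(\alpha,\epsilon,\delta)$-augmented identity tester uses on $(U_n,\hat p)$. -/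

import Mathlib

open scoped ENNReal NNReal

noncomputable section

namespace AugTest

/-- The probability mass `p(S)` of a set `S ⊆ [n]` under a distribution `p` over `[n]`. -/
def mass {n : ℕ} (p : PMF (Fin n)) (S : Finset (Fin n)) : ℝ :=
  ∑ i ∈ S, (p i).toReal

/-- Total variation distance: the supremum over all `S ⊆ [n]` of `|p(S) - q(S)|`. The supremum is
over a finite nonempty family, so it is a maximum. -/
def tv {n : ℕ} (p q : PMF (Fin n)) : ℝ :=
  ⨆ S : Finset (Fin n), |mass p S - mass q S|

/-- A randomized algorithm that draws a fixed number of samples from a distribution over `[n]` and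
answers in `O`: for each sample sequence, `out` gives the law of the answer over the internal
randomness of the algorithm. -/
structure SampleAlg (n : ℕ) (O : Type) where
  samples : ℕ
  out : (Fin samples → Fin n) → PMF O

/-- The probability that the algorithm answers `o` when its samples are i.i.d. from `p`. -/
def SampleAlg.prob {n : ℕ} {O : Type} (A : SampleAlg n O) (p : PMF (Fin n)) (o : O) : ℝ :=
  ∑ x : Fin A.samples → Fin n, (∏ j, (p (x j)).toReal) * (A.out x o).toReal

/-- Answers of a standard tester. -/
inductive Verdict : Type
  | accept
  | reject

/-- Answers of an augmented tester. -/
inductive Answer : Type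
  | accept
  | reject
  | inaccurate

/-- A verdict of a standard tester, read as an answer of an augmented tester. -/
def Verdict.toAnswer : Verdict → Answer
  | .accept => .accept
  | .reject => .reject

/-- A standard identity tester with proximity parameter `ε` and error probability `η`: it is given
the description of `q` and has sample access to `p`. -/
def IsStandardIdentityTester {n : ℕ} (ε η : ℝ) (T : PMF (Fin n) → SampleAlg n Verdict) : Prop :=
  ∀ q p : PMF (Fin n),
    (p = q → (T q).prob p .reject ≤ η) ∧
    (ε < tv p q → (T q).prob p .accept ≤ η)

/-- The three requirements on an augmented tester once the known distributions `q` and `phat` are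
fixed; the unknown distribution `p` is arbitrary. -/
def IsAugmentedFor {n : ℕ} (α ε δ : ℝ) (q phat : PMF (Fin n)) (A : SampleAlg n Answer) : Prop :=
  ∀ p : PMF (Fin n),
    (tv p phat ≤ α → A.prob p .inaccurate ≤ δ / 2) ∧
    (p = q → A.prob p .reject ≤ δ / 2) ∧
    (ε < tv p q → A.prob p .accept ≤ δ / 2)

/-- An `(α, ε, δ)`-augmented tester for identity testing over `[n]`: it is given the descriptions
of `q` and of the prediction `phat` and has sample access to `p`. -/
def IsAugmentedIdentityTester {n : ℕ} (α ε δ : ℝ)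
    (A : PMF (Fin n) → PMF (Fin n) → SampleAlg n Answer) : Prop :=
  ∀ q phat : PMF (Fin n), IsAugmentedFor α ε δ q phat (A q phat)

/-- The Scheffé set of `phat` and `q`: all `x` with `phat x < q x`. -/
def scheffeSet {n : ℕ} (q phat : PMF (Fin n)) : Finset (Fin n) :=
  Finset.univ.filter fun x => phat x < q x

/-- The fraction of the samples that lie in `S`. -/
def sampleFraction {n m : ℕ} (S : Finset (Fin n)) (x : Fin m → Fin n) : ℝ :=
  ((Finset.univ.filter fun j => x j ∈ S).card : ℝ) / m

/-- The branch of the augmented tester that uses the prediction: draw `m = ⌈K / (d - α)²⌉` samples,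
where `d` is the total variation distance of `q` and `phat`, estimate the mass of the Scheffé set,
and answer `reject` if the estimate differs from its mass under `q` by more than `(d - α) / 4`,
and `inaccurate` otherwise. -/
def scheffeBranch {n : ℕ} (K α : ℝ) (q phat : PMF (Fin n)) : SampleAlg n Answer where
  samples := ⌈K / (tv q phat - α) ^ 2⌉₊
  out x :=
    if (tv q phat - α) / 4 <
        |mass q (scheffeSet q phat) - sampleFraction (scheffeSet q phat) x| then
      PMF.pure .reject
    else
      PMF.pure .inaccurate

/-- The branch that returns the answer of the standard tester. -/
def standardBranch {n : ℕ} (T : SampleAlg n Verdict) : SampleAlg n Answer where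
  samples := T.samples
  out x := (T.out x).map Verdict.toAnswer

open scoped Classical in
/-- The augmented identity tester of the paper. Here `T` is the standard identity tester that it
calls (for the same `n` and `ε`), and `K` is the constant hidden in its number of samples
`m = O(1 / (d - α)²)`. -/
def augmentedIdentityTester {n : ℕ} (K : ℝ) (T : PMF (Fin n) → SampleAlg n Verdict) (α ε : ℝ)
    (q phat : PMF (Fin n)) : SampleAlg n Answer :=
  if tv q phat ≤ α ∨ 1 / (tv q phat - α) ^ 2 > √(n : ℝ) / ε ^ 2 then
    standardBranch (T q)
  else
    scheffeBranch K α q phat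

/-- `√n / ε²` as an extended nonnegative real; it is `∞` if `ε = 0` and `n ≠ 0`. -/
def standardRate (n : ℕ) (ε : ℝ) : ℝ≥0∞ :=
  ENNReal.ofReal √(n : ℝ) / ENNReal.ofReal (ε ^ 2)

open scoped Classical in
/-- The sample complexity of augmented identity testing, up to constants: `√n / ε²` if `d ≤ α`, and
`min (1 / (d - α)²) (√n / ε²)` if `α < d`. -/
def augmentedRate (n : ℕ) (α ε d : ℝ) : ℝ≥0∞ :=
  if d ≤ α then standardRate n ε
  else min (1 / ENNReal.ofReal ((d - α) ^ 2)) (standardRate n ε)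

end AugTest

end

/-!
The standard tester thresholds an unbiased estimate of a weighted squared distance of `p` from `q`:
the inner product, with weights `1 / max (q i) (1 / n)`, of the centred counts of two independent
batches of samples. The law of total variance bounds its variance, and Chebyshev's inequality gives
the test. The Scheffé branch is Chebyshev's inequality for the number of samples in the Scheffé
set, whose masses under `q` and `phat` differ by exactly `d`.

For the lower bound, the three answers have total probability `1` on uniform samples. If the
samples do not suffice to tell the uniform distribution from some distribution within `α` of `phat`,
nor from some distribution far from uniform, then each answer has probability at most about
`δ / 2 < 1 / 3`, a contradiction. Indistinguishability is the second moment method (the `χ²`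
distance of the laws of the samples). The far distribution moves mass, in each block of four
elements, to a random one; since the choices in different blocks are independent, detecting it
takes `√n / ε²` samples. The prediction tilts half of the elements against the other half up to
distance `d`; stopping the same tilt at distance `d - α` gives a distribution within `α` of it whose
detection takes `1 / (d - α)²` samples.
-/

noncomputable section

namespace AugTest

open MeasureTheory ProbabilityTheory

open scoped BigOperators

section ProbabilityVector

variable {κ : Type*}

/-- The probability vector of a distribution, with real entries. -/
def probVec (p : PMF κ) (i : κ) : ℝ := (p i).toReal

theorem probVec_nonneg (p : PMF κ) (i : κ) : 0 ≤ probVec p i := ENNReal.toReal_nonneg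

theorem probVec_le_one (p : PMF κ) (i : κ) : probVec p i ≤ 1 :=
  ENNReal.toReal_le_of_le_ofReal zero_le_one (by simpa using p.coe_le_one i)

variable [Fintype κ]

theorem sum_probVec (p : PMF κ) : ∑ i, probVec p i = 1 := by
  simp only [probVec]
  rw [← ENNReal.toReal_sum fun i _ => p.apply_ne_top i, ← tsum_fintype (L := .unconditional _),
    p.tsum_coe, ENNReal.toReal_one]

theorem sum_probVec_sub (p q : PMF κ) : ∑ i, (probVec p i - probVec q i) = 0 := by
  rw [Finset.sum_sub_distrib, sum_probVec, sum_probVec, sub_self]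

/-- The distribution with a given probability vector. -/
def ofProbVec (v : κ → ℝ) (hv : ∀ i, 0 ≤ v i) (hsum : ∑ i, v i = 1) : PMF κ :=
  PMF.ofFintype (fun i => ENNReal.ofReal (v i)) <| by
    rw [← ENNReal.ofReal_sum_of_nonneg fun i _ => hv i, hsum, ENNReal.ofReal_one]

theorem probVec_ofProbVec {v : κ → ℝ} (hv : ∀ i, 0 ≤ v i) (hsum : ∑ i, v i = 1) :
    probVec (ofProbVec v hv hsum) = v :=
  funext fun i => by simp [probVec, ofProbVec, ENNReal.toReal_ofReal (hv i)]

theorem probVec_uniformOfFintype [Nonempty κ] (i : κ) :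
    probVec (PMF.uniformOfFintype κ) i = 1 / Fintype.card κ := by
  simp [probVec]

end ProbabilityVector

section TotalVariation

variable {n : ℕ}

theorem mass_sub_mass (p q : PMF (Fin n)) (S : Finset (Fin n)) :
    mass p S - mass q S = ∑ i ∈ S, (probVec p i - probVec q i) :=
  (Finset.sum_sub_distrib ..).symm

theorem abs_mass_sub_le_tv (p q : PMF (Fin n)) (S : Finset (Fin n)) :
    |mass p S - mass q S| ≤ tv p q :=
  le_ciSup (f := fun S : Finset (Fin n) => |mass p S - mass q S|) (Set.finite_range _).bddAbove S

theorem mem_scheffeSet {q phat : PMF (Fin n)} {i : Fin n} :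
    i ∈ scheffeSet q phat ↔ probVec phat i < probVec q i := by
  simp only [scheffeSet, Finset.mem_filter, Finset.mem_univ, true_and, probVec]
  exact (ENNReal.toReal_lt_toReal (phat.apply_ne_top i) (q.apply_ne_top i)).symm

theorem abs_mass_sub_le_half_l1 (p q : PMF (Fin n)) (S : Finset (Fin n)) :
    |mass p S - mass q S| ≤ (∑ i, |probVec p i - probVec q i|) / 2 := by
  have hcompl : |mass p S - mass q S| = |∑ i ∈ Sᶜ, (probVec p i - probVec q i)| := by
    rw [mass_sub_mass, ← abs_neg, neg_eq_of_add_eq_zero_right]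
    exact (Finset.sum_add_sum_compl S _).trans (sum_probVec_sub p q)
  have hS : |mass p S - mass q S| ≤ ∑ i ∈ S, |probVec p i - probVec q i| := by
    rw [mass_sub_mass]
    exact Finset.abs_sum_le_sum_abs _ _
  have hSc := hcompl.trans_le (Finset.abs_sum_le_sum_abs _ _)
  linarith [Finset.sum_add_sum_compl S fun i => |probVec p i - probVec q i|]

theorem mass_sub_mass_scheffeSet_eq_half_l1 (q phat : PMF (Fin n)) :
    mass q (scheffeSet q phat) - mass phat (scheffeSet q phat) =
      (∑ i, |probVec q i - probVec phat i|) / 2 := by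
  set S := scheffeSet q phat
  have habs := Finset.sum_add_sum_compl S fun i => |probVec q i - probVec phat i|
  rw [Finset.sum_congr rfl fun i hi => abs_of_pos (sub_pos.2 (mem_scheffeSet.1 hi)),
    Finset.sum_congr rfl fun i hi => abs_of_nonpos
      (sub_nonpos.2 (not_lt.1 (mem_scheffeSet.not.1 (Finset.mem_compl.1 hi)))),
    Finset.sum_neg_distrib] at habs
  have hsum := (Finset.sum_add_sum_compl S _).trans (sum_probVec_sub q phat)
  rw [mass_sub_mass]
  linarith

theorem tv_eq_half_l1 (p q : PMF (Fin n)) :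
    tv p q = (∑ i, |probVec p i - probVec q i|) / 2 := by
  refine le_antisymm (ciSup_le (abs_mass_sub_le_half_l1 p q)) ?_
  rw [← mass_sub_mass_scheffeSet_eq_half_l1]
  exact (le_abs_self _).trans (abs_mass_sub_le_tv p q _)

theorem mass_sub_mass_scheffeSet (q phat : PMF (Fin n)) :
    mass q (scheffeSet q phat) - mass phat (scheffeSet q phat) = tv q phat := by
  rw [mass_sub_mass_scheffeSet_eq_half_l1, tv_eq_half_l1]

theorem tv_le_one (p q : PMF (Fin n)) : tv p q ≤ 1 := by
  have h : ∑ i, |probVec p i - probVec q i| ≤ ∑ i, (probVec p i + probVec q i) :=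
    Finset.sum_le_sum fun i _ => (abs_sub _ _).trans_eq <| by
      rw [abs_of_nonneg (probVec_nonneg p i), abs_of_nonneg (probVec_nonneg q i)]
  rw [Finset.sum_add_distrib, sum_probVec, sum_probVec] at h
  rw [tv_eq_half_l1]
  linarith

end TotalVariation

section IIDSamples

variable {κ : Type*} [MeasurableSpace κ] [MeasurableSingletonClass κ]

/-- The joint law of `m` i.i.d. samples from `p`. -/
def iid (p : PMF κ) (m : ℕ) : Measure (Fin m → κ) := Measure.pi fun _ => p.toMeasure

instance (p : PMF κ) (m : ℕ) : IsProbabilityMeasure (iid p m) := by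
  unfold iid
  infer_instance

theorem integral_toMeasure [Fintype κ] (p : PMF κ) (u : κ → ℝ) :
    ∫ i, u i ∂p.toMeasure = ∑ i, probVec p i * u i :=
  PMF.integral_eq_sum p u

theorem integral_iid [Fintype κ] (p : PMF κ) {m : ℕ} (f : (Fin m → κ) → ℝ) :
    ∫ x, f x ∂iid p m = ∑ x, (∏ j, probVec p (x j)) * f x := by
  rw [integral_fintype .of_finite]
  refine Finset.sum_congr rfl fun x _ => ?_
  simp only [iid, measureReal_def, Measure.pi_singleton, ENNReal.toReal_prod, smul_eq_mul,
    PMF.toMeasure_apply_singleton _ _ (measurableSet_singleton _), probVec]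

theorem integral_iid_sum [Fintype κ] (p : PMF κ) (m : ℕ) (u : κ → ℝ) :
    ∫ x, ∑ j, u (x j) ∂iid p m = m * ∑ i, probVec p i * u i := by
  rw [integral_finsetSum _ fun _ _ => .of_finite, ← integral_toMeasure]
  simp [iid, integral_comp_eval (μ := fun _ : Fin m => p.toMeasure) (f := u) .of_discrete]

theorem variance_iid_sum [Finite κ] (p : PMF κ) (m : ℕ) (u : κ → ℝ) :
    Var[fun x => ∑ j, u (x j); iid p m] = m * Var[u; p.toMeasure] := by
  rw [← Finset.sum_fn]
  refine (variance_sum_pi (X := fun _ => u) fun _ => .of_discrete).trans ?_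
  simp

theorem integral_iid_add [Finite κ] (p : PMF κ) (m m' : ℕ)
    (f : (Fin m → κ) → (Fin m' → κ) → ℝ) :
    ∫ z, f (fun j => z (Fin.castAdd m' j)) (fun j => z (Fin.natAdd m j)) ∂iid p (m + m') =
      ∫ x, ∫ y, f x y ∂iid p m' ∂iid p m := by
  cases nonempty_fintype κ
  simp only [integral_iid, Finset.mul_sum]
  rw [← (Fin.appendEquiv m m').sum_comp, Fintype.sum_prod_type]
  refine Finset.sum_congr rfl fun x _ => Finset.sum_congr rfl fun y _ => ?_
  simp only [Fin.prod_univ_add, Fin.appendEquiv, Equiv.coe_fn_mk, Fin.append_left,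
    Fin.append_right, mul_assoc]

/-- The law of total variance, conditioning on the first `m` samples. -/
theorem variance_iid_add [Finite κ] (p : PMF κ) (m m' : ℕ)
    (f : (Fin m → κ) → (Fin m' → κ) → ℝ) :
    Var[fun z => f (fun j => z (Fin.castAdd m' j)) (fun j => z (Fin.natAdd m j)); iid p (m + m')] =
      ∫ x, Var[f x; iid p m'] ∂iid p m + Var[fun x => ∫ y, f x y ∂iid p m'; iid p m] := by
  have hcond (x) : Var[f x; iid p m'] = ∫ y, f x y ^ 2 ∂iid p m' - (∫ y, f x y ∂iid p m') ^ 2 :=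
    variance_eq_sub .of_discrete
  rw [variance_eq_sub .of_discrete, variance_eq_sub .of_discrete]
  simp only [hcond, Pi.pow_apply]
  rw [integral_iid_add p m m' f, integral_iid_add p m m' fun x y => f x y ^ 2,
    integral_sub .of_finite .of_finite]
  ring

end IIDSamples

namespace SampleAlg

variable {n : ℕ} {O : Type}

theorem prob_eq_integral (A : SampleAlg n O) (p : PMF (Fin n)) (o : O) :
    A.prob p o = ∫ x, probVec (A.out x) o ∂iid p A.samples :=
  (integral_iid p _).symm

theorem prob_le_variance_div_sq (A : SampleAlg n O) (p : PMF (Fin n)) (o : O)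
    {Z : (Fin A.samples → Fin n) → ℝ} {μ t : ℝ} (hμ : ∫ x, Z x ∂iid p A.samples = μ) (ht : 0 < t)
    (h : ∀ x, |Z x - μ| < t → probVec (A.out x) o = 0) :
    A.prob p o ≤ Var[Z; iid p A.samples] / t ^ 2 := by
  rw [prob_eq_integral, variance_eq_integral (Measurable.of_discrete).aemeasurable, hμ,
    ← integral_div]
  refine integral_mono .of_finite .of_finite fun x => ?_
  by_cases hx : |Z x - μ| < t
  · rw [h x hx]
    positivity
  · refine (probVec_le_one _ _).trans ((one_le_div (by positivity)).2 ?_)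
    rw [← sq_abs (Z x - μ)]
    exact pow_le_pow_left₀ ht.le (not_lt.1 hx) 2

end SampleAlg

section PairStatistic

variable {κ : Type*} [Fintype κ] [DecidableEq κ] {m : ℕ}

/-- The number of samples equal to `i`, minus its expectation under `q`. -/
def centredCount (q : PMF κ) (x : Fin m → κ) (i : κ) : ℝ :=
  ∑ j, ((if x j = i then 1 else 0) - probVec q i)

/-- The inner product, with weights `1 / w`, of the centred counts of two batches of samples. It
estimates the weighted squared distance from `q` without the bias that the squared counts of a
single batch would have. -/
def pairStat (q : PMF κ) (w : κ → ℝ) (x y : Fin m → κ) : ℝ :=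
  ∑ i, centredCount q x i / w i * centredCount q y i

theorem sum_mul_centredCount (q : PMF κ) (a : κ → ℝ) (x : Fin m → κ) :
    ∑ i, a i * centredCount q x i = ∑ j, (a (x j) - ∑ i, a i * probVec q i) := by
  simp only [centredCount, Finset.mul_sum, mul_sub]
  rw [Finset.sum_comm]
  simp [Finset.sum_sub_distrib]

variable [MeasurableSpace κ] [MeasurableSingletonClass κ]

theorem integral_sum_mul_centredCount (p q : PMF κ) (m : ℕ) (a : κ → ℝ) :
    ∫ x, ∑ i, a i * centredCount q x i ∂iid p m =
      m * ∑ i, a i * (probVec p i - probVec q i) := by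
  simp only [sum_mul_centredCount, integral_iid_sum p m fun k => a k - ∑ i, a i * probVec q i]
  simp only [mul_sub, sub_mul, Finset.sum_sub_distrib, ← Finset.sum_mul, sum_probVec, one_mul,
    mul_comm (a _)]

theorem variance_sum_mul_centredCount_le (p q : PMF κ) (m : ℕ) (a : κ → ℝ) :
    Var[fun x => ∑ i, a i * centredCount q x i; iid p m] ≤ m * ∑ i, probVec p i * a i ^ 2 := by
  simp only [sum_mul_centredCount, variance_iid_sum p m fun k => a k - ∑ i, a i * probVec q i]
  rw [variance_sub_const (Measurable.of_discrete).aestronglyMeasurable, ← integral_toMeasure]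
  gcongr
  exact variance_le_expectation_sq (Measurable.of_discrete).aestronglyMeasurable

omit [Fintype κ] in
theorem integral_centredCount_sq_le [Finite κ] (p q : PMF κ) (m : ℕ) (i : κ) :
    ∫ x, centredCount q x i ^ 2 ∂iid p m ≤
      m * probVec p i + m ^ 2 * (probVec p i - probVec q i) ^ 2 := by
  cases nonempty_fintype κ
  have hcount : (fun x : Fin m → κ => ∑ k, (if k = i then 1 else 0) * centredCount q x k) =
      fun x => centredCount q x i := by simp
  have hvar := variance_sum_mul_centredCount_le p q m fun k => if k = i then 1 else 0
  have hmean := integral_sum_mul_centredCount p q m fun k => if k = i then 1 else 0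
  rw [hcount, variance_eq_sub .of_discrete] at hvar
  rw [hcount] at hmean
  simp only [hmean, Pi.pow_apply, ite_pow, one_pow, ne_eq, OfNat.ofNat_ne_zero, not_false_eq_true,
    zero_pow, mul_ite, ite_mul, one_mul, zero_mul, mul_one, mul_zero, Finset.sum_ite_eq',
    Finset.mem_univ, if_true] at hvar
  linarith

variable (p q : PMF κ) (m : ℕ) (w : κ → ℝ)

theorem integral_pairStat_right (x : Fin m → κ) :
    ∫ y, pairStat q w x y ∂iid p m =
      m * ∑ i, (probVec p i - probVec q i) / w i * centredCount q x i := by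
  simp only [pairStat, integral_sum_mul_centredCount p q m fun i => centredCount q x i / w i]
  congr! 2 with i
  ring

theorem integral_pairStat :
    ∫ x, ∫ y, pairStat q w x y ∂iid p m ∂iid p m =
      m ^ 2 * ∑ i, (probVec p i - probVec q i) ^ 2 / w i := by
  simp only [integral_pairStat_right, integral_const_mul, integral_sum_mul_centredCount]
  rw [← mul_assoc, ← sq]
  congr! 2 with i
  ring

theorem integral_variance_pairStat_right_le :
    ∫ x, Var[pairStat q w x; iid p m] ∂iid p m ≤
      m ^ 2 * ∑ i, probVec p i ^ 2 / w i ^ 2 +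
        m ^ 3 * ∑ i, probVec p i * (probVec p i - probVec q i) ^ 2 / w i ^ 2 := by
  calc ∫ x, Var[pairStat q w x; iid p m] ∂iid p m
      ≤ ∫ x, m * ∑ i, probVec p i * (centredCount q x i / w i) ^ 2 ∂iid p m :=
        integral_mono .of_finite .of_finite fun x => variance_sum_mul_centredCount_le p q m _
    _ = m * ∑ i, probVec p i / w i ^ 2 * ∫ x, centredCount q x i ^ 2 ∂iid p m := by
        simp only [integral_const_mul, integral_finsetSum _ fun _ _ => Integrable.of_finite,
          div_pow, integral_div, mul_div_assoc', div_mul_eq_mul_div]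
    _ ≤ m * ∑ i, probVec p i / w i ^ 2 *
          (m * probVec p i + m ^ 2 * (probVec p i - probVec q i) ^ 2) := by
        gcongr with i
        · exact div_nonneg (probVec_nonneg p i) (sq_nonneg _)
        · exact integral_centredCount_sq_le p q m i
    _ = _ := by
        simp only [Finset.mul_sum, ← Finset.sum_add_distrib]
        exact Finset.sum_congr rfl fun i _ => by ring

theorem variance_integral_pairStat_right_le :
    Var[fun x => ∫ y, pairStat q w x y ∂iid p m; iid p m] ≤
      m ^ 3 * ∑ i, probVec p i * (probVec p i - probVec q i) ^ 2 / w i ^ 2 := by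
  simp only [integral_pairStat_right]
  rw [variance_const_mul]
  refine (mul_le_mul_of_nonneg_left (variance_sum_mul_centredCount_le p q m _)
    (sq_nonneg _)).trans_eq ?_
  simp only [div_pow, mul_div_assoc']
  ring

/-- `pairStat` of the two halves of a sequence of `m + m` samples. -/
def splitPairStat (q : PMF κ) (w : κ → ℝ) {m : ℕ} (z : Fin (m + m) → κ) : ℝ :=
  pairStat q w (fun j => z (Fin.castAdd m j)) (fun j => z (Fin.natAdd m j))

theorem integral_splitPairStat :
    ∫ z, splitPairStat q w z ∂iid p (m + m) =
      m ^ 2 * ∑ i, (probVec p i - probVec q i) ^ 2 / w i :=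
  (integral_iid_add p m m (pairStat q w)).trans (integral_pairStat p q m w)

theorem variance_splitPairStat_le :
    Var[splitPairStat q w; iid p (m + m)] ≤
      m ^ 2 * ∑ i, probVec p i ^ 2 / w i ^ 2 +
        2 * m ^ 3 * ∑ i, probVec p i * (probVec p i - probVec q i) ^ 2 / w i ^ 2 := by
  refine (variance_iid_add p m m (pairStat q w)).trans_le ?_
  linarith [integral_variance_pairStat_right_le p q m w,
    variance_integral_pairStat_right_le p q m w]

end PairStatistic

section FlooredWeights

variable {κ : Type*} [Fintype κ]

/-- The larger of `q i` and the uniform mass: with these weights an element that is rare under `q`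
does not blow up the variance of `pairStat`. -/
def flooredWeight (q : PMF κ) (i : κ) : ℝ := max (probVec q i) (1 / Fintype.card κ)

/-- The squared distance of `p` from `q` weighted by `1 / flooredWeight q`, a variant of the
`χ²`-divergence that is finite for all `p`. -/
def weightedSqDist (p q : PMF κ) : ℝ :=
  ∑ i, (probVec p i - probVec q i) ^ 2 / flooredWeight q i

variable (p q : PMF κ)

theorem flooredWeight_pos (i : κ) : 0 < flooredWeight q i :=
  have : Nonempty κ := ⟨i⟩
  lt_max_of_lt_right (one_div_pos.2 (Nat.cast_pos.2 Fintype.card_pos))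

theorem one_le_card_mul_flooredWeight (i : κ) : 1 ≤ Fintype.card κ * flooredWeight q i :=
  have : Nonempty κ := ⟨i⟩
  (div_le_iff₀' (Nat.cast_pos.2 Fintype.card_pos)).1 (le_max_right _ _)

theorem sum_flooredWeight_le_two : ∑ i, flooredWeight q i ≤ 2 := by
  calc ∑ i, flooredWeight q i ≤ ∑ i, (probVec q i + 1 / Fintype.card κ) :=
        Finset.sum_le_sum fun i _ => max_le_add_of_nonneg (probVec_nonneg q i) (by positivity)
    _ = 1 + Fintype.card κ * (1 / Fintype.card κ) := by
        rw [Finset.sum_add_distrib, sum_probVec, Finset.sum_const, nsmul_eq_mul, Finset.card_univ]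
    _ ≤ 2 := by
        rw [mul_one_div]
        linarith [div_self_le_one (Fintype.card κ : ℝ)]

theorem weightedSqDist_nonneg : 0 ≤ weightedSqDist p q :=
  Finset.sum_nonneg fun i _ => div_nonneg (sq_nonneg _) (flooredWeight_pos q i).le

theorem weightedSqDist_self : weightedSqDist p p = 0 := by simp [weightedSqDist]

theorem sq_sum_abs_sub_le_weightedSqDist :
    (∑ i, |probVec p i - probVec q i|) ^ 2 ≤ 2 * weightedSqDist p q := by
  obtain ⟨i, -⟩ := q.support_nonempty
  have hw : 0 < ∑ i, flooredWeight q i :=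
    Finset.sum_pos (fun i _ => flooredWeight_pos q i) ⟨i, Finset.mem_univ i⟩
  have hcs := Finset.sq_sum_div_le_sum_sq_div Finset.univ (fun i => |probVec p i - probVec q i|)
    fun i _ => flooredWeight_pos q i
  simp only [sq_abs] at hcs
  exact ((div_le_iff₀' hw).1 hcs).trans
    (mul_le_mul_of_nonneg_right (sum_flooredWeight_le_two q) (weightedSqDist_nonneg p q))

theorem sq_div_flooredWeight_sq_le (a : ℝ) (i : κ) :
    a ^ 2 / flooredWeight q i ^ 2 ≤ Fintype.card κ * (a ^ 2 / flooredWeight q i) := by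
  have hw := flooredWeight_pos q i
  calc a ^ 2 / flooredWeight q i ^ 2 = 1 / flooredWeight q i * (a ^ 2 / flooredWeight q i) := by
        field_simp
    _ ≤ Fintype.card κ * (a ^ 2 / flooredWeight q i) := by
        gcongr
        exact (div_le_iff₀ hw).2 (one_le_card_mul_flooredWeight q i)

theorem sum_sq_div_flooredWeight_sq_le :
    ∑ i, probVec p i ^ 2 / flooredWeight q i ^ 2 ≤
      2 * Fintype.card κ * weightedSqDist p q + 2 * Fintype.card κ := by
  have hterm (i : κ) : probVec p i ^ 2 / flooredWeight q i ^ 2 ≤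
      2 * Fintype.card κ * ((probVec p i - probVec q i) ^ 2 / flooredWeight q i) + 2 := by
    have hq : (probVec q i / flooredWeight q i) ^ 2 ≤ 1 :=
      pow_le_one₀ (div_nonneg (probVec_nonneg q i) (flooredWeight_pos q i).le)
        ((div_le_one (flooredWeight_pos q i)).2 (le_max_left _ _))
    have hdiff := sq_div_flooredWeight_sq_le q (probVec p i - probVec q i) i
    rw [← div_pow, sub_div] at hdiff
    rw [← div_pow]
    nlinarith [sq_nonneg (probVec p i / flooredWeight q i - 2 * (probVec q i / flooredWeight q i))]
  refine (Finset.sum_le_sum fun i _ => hterm i).trans_eq ?_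
  rw [Finset.sum_add_distrib, ← Finset.mul_sum, ← weightedSqDist, Finset.sum_const, nsmul_eq_mul,
    Finset.card_univ, mul_comm (Fintype.card κ : ℝ) 2]

theorem sum_mul_sq_div_flooredWeight_sq_le :
    ∑ i, probVec p i * (probVec p i - probVec q i) ^ 2 / flooredWeight q i ^ 2 ≤
      (1 + √(Fintype.card κ * weightedSqDist p q)) * weightedSqDist p q := by
  have hratio (i : κ) :
      probVec p i / flooredWeight q i ≤ 1 + √(Fintype.card κ * weightedSqDist p q) := by
    have hdiff : ((probVec p i - probVec q i) / flooredWeight q i) ^ 2 ≤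
        Fintype.card κ * weightedSqDist p q := by
      rw [div_pow]
      refine (sq_div_flooredWeight_sq_le q _ i).trans ?_
      gcongr
      exact Finset.single_le_sum
        (f := fun i => (probVec p i - probVec q i) ^ 2 / flooredWeight q i)
        (fun j _ => div_nonneg (sq_nonneg _) (flooredWeight_pos q j).le) (Finset.mem_univ i)
    have hq : probVec q i / flooredWeight q i ≤ 1 :=
      (div_le_one (flooredWeight_pos q i)).2 (le_max_left _ _)
    have := (le_abs_self _).trans (Real.abs_le_sqrt hdiff)
    rw [sub_div] at this
    linarith
  refine (Finset.sum_le_sum fun i _ => ?_).trans_eq (Finset.mul_sum ..).symm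
  rw [sq (flooredWeight q i), mul_div_mul_comm]
  exact mul_le_mul_of_nonneg_right (hratio i)
    (div_nonneg (sq_nonneg _) (flooredWeight_pos q i).le)

end FlooredWeights

section PairTester

variable {n : ℕ}

open scoped Classical in
/-- The standard tester that draws two batches of `m` samples and thresholds `pairStat` with weights
`flooredWeight q` at `(m ε)²`, half of its least expectation under a distribution far from `q`. -/
def pairTester (m : ℕ) (ε : ℝ) (q : PMF (Fin n)) : SampleAlg n Verdict where
  samples := m + m
  out z := if splitPairStat q (flooredWeight q) z ≤ (m * ε) ^ 2 then PMF.pure .accept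
    else PMF.pure .reject

theorem pos_of_pmf (q : PMF (Fin n)) : 0 < n :=
  q.support_nonempty.some.pos

theorem one_le_sqrt_of_pmf (q : PMF (Fin n)) : 1 ≤ √(n : ℝ) :=
  Real.one_le_sqrt.2 (Nat.one_le_cast.2 (pos_of_pmf q))

theorem variance_splitPairStat_flooredWeight_le (p q : PMF (Fin n)) (m : ℕ) :
    Var[splitPairStat q (flooredWeight q); iid p (m + m)] ≤
      m ^ 2 * (2 * n * weightedSqDist p q + 2 * n) +
        2 * m ^ 3 * ((1 + √(n * weightedSqDist p q)) * weightedSqDist p q) := by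
  have h := sum_sq_div_flooredWeight_sq_le p q
  have h' := sum_mul_sq_div_flooredWeight_sq_le p q
  rw [Fintype.card_fin] at h h'
  refine (variance_splitPairStat_le p q m (flooredWeight q)).trans ?_
  gcongr

theorem two_mul_sq_le_weightedSqDist {p q : PMF (Fin n)} {ε : ℝ} (hε : 0 ≤ ε) (h : ε ≤ tv p q) :
    2 * ε ^ 2 ≤ weightedSqDist p q := by
  rw [tv_eq_half_l1] at h
  have := pow_le_pow_left₀ (by positivity) (show 2 * ε ≤ _ by linarith) 2
  linarith [sq_sum_abs_sub_le_weightedSqDist p q]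

theorem pairTester_prob_reject_le (p : PMF (Fin n)) {m : ℕ} {ε : ℝ}
    (hm : 400 * √(n : ℝ) ≤ m * ε ^ 2) : (pairTester m ε p).prob p .reject ≤ 1 / 20 := by
  have hmε : 0 < m * ε ^ 2 := by linarith [one_le_sqrt_of_pmf p]
  have hmean : ∫ z, splitPairStat p (flooredWeight p) z ∂iid p (m + m) = 0 := by
    rw [integral_splitPairStat]
    simp
  have hvar := variance_splitPairStat_flooredWeight_le p p m
  simp only [weightedSqDist_self, mul_zero, add_zero, zero_add] at hvar
  have ht : 0 < (m * ε) ^ 2 := by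
    rw [mul_pow, sq (m : ℝ), mul_assoc]
    exact mul_pos (pos_of_mul_pos_left hmε (sq_nonneg ε)) hmε
  refine ((pairTester m ε p).prob_le_variance_div_sq p _ hmean ht
    fun z hz => ?_).trans ((div_le_iff₀ (by positivity)).2 (hvar.trans ?_))
  · have hle : splitPairStat p (flooredWeight p) z ≤ (m * ε) ^ 2 := by
      rw [sub_zero] at hz
      exact (le_abs_self _).trans hz.le
    simp only [pairTester, if_pos hle]
    simp [probVec]
  · have hsq := pow_le_pow_left₀ (by positivity) hm 2
    rw [mul_pow, Real.sq_sqrt (by positivity)] at hsq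
    linarith [mul_le_mul_of_nonneg_left hsq (sq_nonneg (m : ℝ)),
      mul_nonneg (sq_nonneg (m : ℝ)) (Nat.cast_nonneg (α := ℝ) n)]

theorem far_variance_bound {r s ε M : ℝ} (hr : 1 ≤ r) (hε : 0 < ε) (hε1 : ε ≤ 1) (hs : 0 ≤ s)
    (hεs : 2 * ε ^ 2 ≤ s ^ 2) (hM : 400 * r ≤ M * ε ^ 2) :
    4 * (2 * r ^ 2 * s ^ 2 + 2 * r ^ 2) + 8 * M * ((1 + r * s) * s ^ 2) ≤
      1 / 20 * (M * s ^ 2) ^ 2 := by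
  have hM0 : 0 < M := pos_of_mul_pos_left (by linarith) (sq_nonneg ε)
  have hMs2 : 800 * r ≤ M * s ^ 2 := by
    linarith [mul_le_mul_of_nonneg_left hεs hM0.le]
  have hMs : 400 * r ≤ M * s := by
    have hε2s : ε ^ 2 ≤ s := by
      refine (abs_le_of_sq_le_sq' ?_ hs).2
      nlinarith [pow_le_one₀ hε.le hε1 (n := 2), sq_nonneg ε]
    linarith [mul_le_mul_of_nonneg_left hε2s hM0.le]
  have h1 : (800 * r) ^ 2 ≤ (M * s ^ 2) ^ 2 := pow_le_pow_left₀ (by positivity) hMs2 2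
  have h2 : (400 * r) ^ 2 * s ^ 2 ≤ (M * s ^ 2) ^ 2 := by
    rw [sq s, ← mul_assoc M, mul_pow (M * s), ← sq s]
    gcongr
  have h3 : 800 * (M * s ^ 2) ≤ (M * s ^ 2) ^ 2 := by
    rw [sq (M * s ^ 2)]
    gcongr
    linarith
  have h4 : 400 * r * (M * s ^ 3) ≤ (M * s ^ 2) ^ 2 := by
    calc 400 * r * (M * s ^ 3) ≤ M * s * (M * s ^ 3) := by gcongr
      _ = (M * s ^ 2) ^ 2 := by ring
  nlinarith

theorem pairTester_prob_accept_le {p q : PMF (Fin n)} {m : ℕ} {ε : ℝ} (hε : 0 < ε) (hε1 : ε ≤ 1)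
    (hm : 400 * √(n : ℝ) ≤ m * ε ^ 2) (hfar : ε < tv p q) :
    (pairTester m ε q).prob p .accept ≤ 1 / 20 := by
  set D := weightedSqDist p q
  have hD : 2 * ε ^ 2 ≤ D := two_mul_sq_le_weightedSqDist hε.le hfar.le
  have hD0 : 0 < D := lt_of_lt_of_le (by positivity) hD
  have hr := one_le_sqrt_of_pmf q
  have hm0 : 0 < (m : ℝ) := pos_of_mul_pos_left (lt_of_lt_of_le (by linarith) hm) (sq_nonneg ε)
  have hmean : ∫ z, splitPairStat q (flooredWeight q) z ∂iid p (m + m) = m ^ 2 * D :=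
    integral_splitPairStat ..
  refine ((pairTester m ε q).prob_le_variance_div_sq p _ hmean
    (t := m ^ 2 * D / 2) (by positivity) fun z hz => ?_).trans ((div_le_iff₀ (by positivity)).2
      ((variance_splitPairStat_flooredWeight_le p q m).trans ?_))
  · have hlt : (m * ε) ^ 2 < splitPairStat q (flooredWeight q) z := by
      linarith [(abs_lt.1 hz).1, mul_le_mul_of_nonneg_left hD (sq_nonneg (m : ℝ))]
    simp only [pairTester, if_neg hlt.not_ge]
    simp [probVec]
  · have hbound := far_variance_bound hr hε hε1 (Real.sqrt_nonneg D)
      (by rwa [Real.sq_sqrt hD0.le]) hm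
    rw [Real.sq_sqrt hD0.le, Real.sq_sqrt (by positivity), ← Real.sqrt_mul (by positivity)]
      at hbound
    linarith [mul_le_mul_of_nonneg_left hbound (by positivity : (0 : ℝ) ≤ (m : ℝ) ^ 2 / 4)]

/-- The number of samples in each of the two batches of `pairTester`. -/
def batchSize (n : ℕ) (ε : ℝ) : ℕ := ⌈400 * (√(n : ℝ) / ε ^ 2)⌉₊

theorem pairTester_isStandardIdentityTester (n : ℕ) {ε : ℝ} (hε : 0 < ε) (hε1 : ε ≤ 1) :
    IsStandardIdentityTester ε (1 / 20) (pairTester (n := n) (batchSize n ε) ε) := by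
  have hm : 400 * √(n : ℝ) ≤ batchSize n ε * ε ^ 2 := by
    rw [← div_le_iff₀ (by positivity), mul_div_assoc]
    exact Nat.le_ceil _
  exact fun q p => ⟨fun h => h ▸ pairTester_prob_reject_le p hm,
    pairTester_prob_accept_le hε hε1 hm⟩

theorem standardRate_eq_ofReal (n : ℕ) {ε : ℝ} (hε : 0 < ε) :
    standardRate n ε = ENNReal.ofReal (√(n : ℝ) / ε ^ 2) := by
  rw [standardRate, ENNReal.ofReal_div_of_pos (by positivity)]

theorem pairTester_samples_le {ε : ℝ} (hε : 0 < ε) (hε1 : ε ≤ 1) (q : PMF (Fin n)) :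
    ((pairTester (batchSize n ε) ε q).samples : ℝ≥0∞) ≤ (802 : ℝ≥0) * standardRate n ε := by
  have hrate : 1 ≤ √(n : ℝ) / ε ^ 2 :=
    (one_le_div (by positivity)).2 ((pow_le_one₀ hε.le hε1).trans (one_le_sqrt_of_pmf q))
  have hbatch : (batchSize n ε : ℝ) ≤ 400 * (√(n : ℝ) / ε ^ 2) + 1 :=
    (Nat.ceil_lt_add_one (by positivity)).le
  rw [standardRate_eq_ofReal n hε, ← ENNReal.ofReal_natCast, ← ENNReal.ofReal_coe_nnreal,
    ← ENNReal.ofReal_mul (by positivity)]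
  refine ENNReal.ofReal_le_ofReal ?_
  simp only [pairTester, Nat.cast_add, NNReal.coe_ofNat]
  linarith

end PairTester

section ScheffeBranch

variable {n : ℕ}

theorem sampleFraction_eq_sum_div (S : Finset (Fin n)) {m : ℕ} (x : Fin m → Fin n) :
    sampleFraction S x = (∑ j, if x j ∈ S then 1 else 0) / m := by
  rw [sampleFraction, Finset.sum_boole]

theorem integral_sampleFraction (p : PMF (Fin n)) (S : Finset (Fin n)) {m : ℕ} (hm : m ≠ 0) :
    ∫ x, sampleFraction S x ∂iid p m = mass p S := by
  simp only [sampleFraction_eq_sum_div, integral_div,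
    integral_iid_sum p m fun i => if i ∈ S then (1 : ℝ) else 0]
  rw [mul_div_cancel_left₀ _ (Nat.cast_ne_zero.2 hm)]
  simp [mass, probVec]

theorem variance_sampleFraction_le (p : PMF (Fin n)) (S : Finset (Fin n)) (m : ℕ) :
    Var[fun x => sampleFraction S x; iid p m] ≤ 1 / (4 * m) := by
  have hbernoulli : Var[fun i => if i ∈ S then (1 : ℝ) else 0; p.toMeasure] ≤ 1 / 4 := by
    refine (variance_le_sq_of_bounded (a := 0) (b := 1) (.of_forall fun i => ?_)
      (Measurable.of_discrete).aemeasurable).trans_eq (by norm_num)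
    split_ifs <;> simp
  simp only [sampleFraction_eq_sum_div, div_eq_inv_mul]
  rw [variance_const_mul, variance_iid_sum p m fun i => if i ∈ S then (1 : ℝ) else 0]
  calc (m : ℝ)⁻¹ ^ 2 * (m * Var[fun i => if i ∈ S then (1 : ℝ) else 0; p.toMeasure])
      ≤ (m : ℝ)⁻¹ ^ 2 * (m * (1 / 4)) := by gcongr
    _ = (4 * (m : ℝ))⁻¹ * 1 := by
      rcases eq_or_ne (m : ℝ) 0 with h | h
      · simp [h]
      · field_simp

theorem SampleAlg.prob_le_of_sampleFraction {O : Type} (A : SampleAlg n O) (p : PMF (Fin n)) (o : O)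
    (S : Finset (Fin n)) {t : ℝ} (hA : A.samples ≠ 0) (ht : 0 < t)
    (h : ∀ x : Fin A.samples → Fin n, |sampleFraction S x - mass p S| < t →
      probVec (A.out x) o = 0) :
    A.prob p o ≤ 1 / (4 * A.samples * t ^ 2) := by
  refine (A.prob_le_variance_div_sq p o (integral_sampleFraction p S hA) ht h).trans ?_
  rw [← div_div]
  gcongr
  exact variance_sampleFraction_le p S A.samples

theorem SampleAlg.prob_eq_zero {O : Type} {A : SampleAlg n O} {o : O}
    (h : ∀ x, probVec (A.out x) o = 0) (p : PMF (Fin n)) : A.prob p o = 0 := by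
  simp [prob_eq_integral, h]

theorem scheffeBranch_prob_le {K α : ℝ} (hK : 80 ≤ K) {q phat : PMF (Fin n)}
    (hd : α < tv q phat) (p : PMF (Fin n)) (o : Answer)
    (h : ∀ x, |sampleFraction (scheffeSet q phat) x - mass p (scheffeSet q phat)| <
      (tv q phat - α) / 4 → probVec ((scheffeBranch K α q phat).out x) o = 0) :
    (scheffeBranch K α q phat).prob p o ≤ 1 / 20 := by
  have : 0 < tv q phat - α := sub_pos.2 hd
  have hm : 80 ≤ (scheffeBranch K α q phat).samples * (tv q phat - α) ^ 2 :=
    hK.trans ((div_le_iff₀ (by positivity)).1 (Nat.le_ceil _))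
  have hm0 : (scheffeBranch K α q phat).samples ≠ 0 := by
    intro h0
    norm_num [h0] at hm
  refine (SampleAlg.prob_le_of_sampleFraction _ p o _ hm0 (by positivity) h).trans ?_
  gcongr
  linarith

theorem scheffeBranch_isAugmentedFor {K α ε : ℝ} (hK : 80 ≤ K) {q phat : PMF (Fin n)}
    (hd : α < tv q phat) : IsAugmentedFor α ε (1 / 10) q phat (scheffeBranch K α q phat) := by
  set S := scheffeSet q phat
  have hgap : mass q S - mass phat S = tv q phat := mass_sub_mass_scheffeSet q phat
  intro p
  rw [show (1 / 10 : ℝ) / 2 = 1 / 20 by norm_num]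
  refine ⟨fun hp => scheffeBranch_prob_le hK hd p _ fun x hx => ?_, fun hp =>
    scheffeBranch_prob_le hK hd p _ fun x hx => ?_, fun _ =>
    (SampleAlg.prob_eq_zero (fun x => ?_) p).trans_le (by norm_num)⟩
  · have hreject : (tv q phat - α) / 4 < |mass q S - sampleFraction S x| :=
      lt_of_lt_of_le (by linarith [(abs_lt.1 hx).2,
        (abs_le.1 ((abs_mass_sub_le_tv p phat S).trans hp)).2]) (le_abs_self _)
    have hout : (scheffeBranch K α q phat).out x = PMF.pure .reject := if_pos hreject
    simp [hout, probVec]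
  · rw [hp, abs_sub_comm] at hx
    have hout : (scheffeBranch K α q phat).out x = PMF.pure .inaccurate := if_neg hx.not_gt
    simp [hout, probVec]
  · simp only [scheffeBranch, probVec]
    split_ifs <;> simp

theorem scheffeBranch_samples_le {K α : ℝ} (hK : 0 ≤ K) (hα : 0 ≤ α) {q phat : PMF (Fin n)}
    (hd : α < tv q phat) :
    ((scheffeBranch K α q phat).samples : ℝ) ≤ (K + 1) * (1 / (tv q phat - α) ^ 2) := by
  have hgap : 0 < tv q phat - α := sub_pos.2 hd
  have hone : 1 ≤ 1 / (tv q phat - α) ^ 2 :=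
    (one_le_div (by positivity)).2 (pow_le_one₀ hgap.le (by linarith [tv_le_one q phat]))
  have hceil : ((scheffeBranch K α q phat).samples : ℝ) ≤ K / (tv q phat - α) ^ 2 + 1 :=
    (Nat.ceil_lt_add_one (by positivity)).le
  rw [div_eq_mul_one_div] at hceil
  linarith

end ScheffeBranch

section AugmentedTester

variable {n : ℕ}

theorem toAnswer_injective : Function.Injective Verdict.toAnswer := by
  rintro (_ | _) (_ | _) h <;> first | rfl | cases h

theorem standardBranch_prob_toAnswer (T : SampleAlg n Verdict) (p : PMF (Fin n)) (v : Verdict) :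
    (standardBranch T).prob p v.toAnswer = T.prob p v := by
  have hmap (P : PMF Verdict) : (P.map Verdict.toAnswer) v.toAnswer = P v := by
    classical
    rw [PMF.map_apply, tsum_eq_single v fun w hw => if_neg (toAnswer_injective.ne hw.symm),
      if_pos rfl]
  simp only [SampleAlg.prob, standardBranch, hmap]
  rfl

theorem standardBranch_prob_inaccurate (T : SampleAlg n Verdict) (p : PMF (Fin n)) :
    (standardBranch T).prob p .inaccurate = 0 := by
  refine SampleAlg.prob_eq_zero (fun x => ?_) p
  have hsupp : Answer.inaccurate ∉ ((T.out x).map Verdict.toAnswer).support := by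
    rw [PMF.mem_support_map_iff]
    rintro ⟨_ | _, -, h⟩ <;> cases h
  simp only [probVec, standardBranch, (PMF.apply_eq_zero_iff _ _).2 hsupp, ENNReal.toReal_zero]

theorem standardBranch_isAugmentedFor {α ε δ : ℝ} (hδ : 0 ≤ δ)
    {T : PMF (Fin n) → SampleAlg n Verdict} (hT : IsStandardIdentityTester ε (δ / 2) T)
    (q phat : PMF (Fin n)) :
    IsAugmentedFor α ε δ q phat (standardBranch (T q)) := fun p =>
  ⟨fun _ => (standardBranch_prob_inaccurate (T q) p).trans_le (by positivity),
    fun hp => (standardBranch_prob_toAnswer (T q) p .reject).trans_le ((hT q p).1 hp),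
    fun hp => (standardBranch_prob_toAnswer (T q) p .accept).trans_le ((hT q p).2 hp)⟩

theorem augmentedIdentityTester_isAugmentedIdentityTester {K α ε : ℝ} (hK : 80 ≤ K)
    {T : PMF (Fin n) → SampleAlg n Verdict} (hT : IsStandardIdentityTester ε (1 / 20) T) :
    IsAugmentedIdentityTester α ε (1 / 10) (augmentedIdentityTester K T α ε) := by
  intro q phat
  unfold augmentedIdentityTester
  split_ifs with h
  · refine standardBranch_isAugmentedFor (by norm_num) ?_ q phat
    rwa [show (1 / 10 : ℝ) / 2 = 1 / 20 by norm_num]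
  · exact scheffeBranch_isAugmentedFor hK (not_le.1 (not_or.1 h).1)

theorem augmentedRate_of_le {α ε d : ℝ} (h : d ≤ α) :
    augmentedRate n α ε d = standardRate n ε := if_pos h

theorem augmentedRate_of_lt {α ε d : ℝ} (h : α < d) :
    augmentedRate n α ε d = min (ENNReal.ofReal (1 / (d - α) ^ 2)) (standardRate n ε) := by
  have : 0 < d - α := sub_pos.2 h
  rw [augmentedRate, if_neg (not_le.2 h), ENNReal.ofReal_div_of_pos (by positivity),
    ENNReal.ofReal_one]

theorem augmentedIdentityTester_samples_le {K α ε : ℝ} (hK : 0 ≤ K) (hα : 0 ≤ α) (hε : 0 < ε)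
    {C : ℝ≥0} {T : PMF (Fin n) → SampleAlg n Verdict}
    (hT : ∀ q, ((T q).samples : ℝ≥0∞) ≤ C * standardRate n ε) (q phat : PMF (Fin n)) :
    ((augmentedIdentityTester K T α ε q phat).samples : ℝ≥0∞) ≤
      (max C (K + 1).toNNReal : ℝ≥0) * augmentedRate n α ε (tv q phat) := by
  unfold augmentedIdentityTester
  split_ifs with h
  · have hrate : augmentedRate n α ε (tv q phat) = standardRate n ε := by
      rcases le_or_gt (tv q phat) α with hd | hd
      · exact augmentedRate_of_le hd
      · rw [augmentedRate_of_lt hd, standardRate_eq_ofReal n hε]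
        exact min_eq_right (ENNReal.ofReal_le_ofReal (h.resolve_left hd.not_ge).le)
    rw [hrate]
    exact (hT q).trans (mul_le_mul_left (ENNReal.coe_le_coe.2 (le_max_left ..)) _)
  · obtain ⟨hd, hle⟩ := not_or.1 h
    have hrate : augmentedRate n α ε (tv q phat) = ENNReal.ofReal (1 / (tv q phat - α) ^ 2) := by
      rw [augmentedRate_of_lt (not_le.1 hd), standardRate_eq_ofReal n hε]
      exact min_eq_left (ENNReal.ofReal_le_ofReal (not_lt.1 hle))
    rw [hrate]
    calc ((scheffeBranch K α q phat).samples : ℝ≥0∞)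
        ≤ ENNReal.ofReal ((K + 1) * (1 / (tv q phat - α) ^ 2)) := by
          rw [← ENNReal.ofReal_natCast]
          exact ENNReal.ofReal_le_ofReal (scheffeBranch_samples_le hK hα (not_le.1 hd))
      _ = ENNReal.ofReal (K + 1) * ENNReal.ofReal (1 / (tv q phat - α) ^ 2) :=
          ENNReal.ofReal_mul (by positivity)
      _ ≤ (max C (K + 1).toNNReal : ℝ≥0) * ENNReal.ofReal (1 / (tv q phat - α) ^ 2) :=
          mul_le_mul_left (ENNReal.coe_le_coe.2 (le_max_right ..)) _

end AugmentedTester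

section SecondMomentMethod

theorem sq_sum_sub_sum_le_chiSq {Ω : Type*} [Fintype Ω] {P M φ : Ω → ℝ} (hP : ∀ x, 0 < P x)
    (hPsum : ∑ x, P x = 1) (hMsum : ∑ x, M x = 1) (h0 : ∀ x, 0 ≤ φ x) (h1 : ∀ x, φ x ≤ 1) :
    (∑ x, P x * φ x - ∑ x, M x * φ x) ^ 2 ≤ ∑ x, M x ^ 2 / P x - 1 := by
  have hchi : ∑ x, (M x - P x) ^ 2 / P x = ∑ x, M x ^ 2 / P x - 1 := by
    have h (x : Ω) : (M x - P x) ^ 2 / P x = M x ^ 2 / P x - 2 * M x + P x := by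
      have := (hP x).ne'
      field_simp
      ring
    simp only [h, Finset.sum_add_distrib, Finset.sum_sub_distrib, ← Finset.mul_sum, hPsum, hMsum]
    ring
  have hφ : ∑ x, P x * φ x ^ 2 ≤ 1 :=
    hPsum ▸ Finset.sum_le_sum fun x _ =>
      mul_le_of_le_one_right (hP x).le (pow_le_one₀ (h0 x) (h1 x))
  calc (∑ x, P x * φ x - ∑ x, M x * φ x) ^ 2 = (∑ x, (M x - P x) * φ x) ^ 2 := by
        rw [← neg_sq, neg_sub, ← Finset.sum_sub_distrib]
        simp only [sub_mul]
    _ ≤ (∑ x, (M x - P x) ^ 2 / P x) * ∑ x, P x * φ x ^ 2 :=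
        Finset.sum_sq_le_sum_mul_sum_of_sq_le_mul _
          (fun x _ => div_nonneg (sq_nonneg _) (hP x).le)
          (fun x _ => mul_nonneg (hP x).le (sq_nonneg _)) fun x _ => le_of_eq <| by
            have := (hP x).ne'
            field_simp
    _ ≤ ∑ x, (M x - P x) ^ 2 / P x :=
        mul_le_of_le_one_right (Finset.sum_nonneg fun x _ => div_nonneg (sq_nonneg _) (hP x).le) hφ
    _ = _ := hchi

variable {κ Z : Type*} [Fintype κ] [Fintype Z] {m : ℕ}

/-- The density, with respect to counting measure, of the uniform mixture over `z` of the laws of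
`m` i.i.d. samples from `p z`. -/
def iidMixture (p : Z → PMF κ) (m : ℕ) (x : Fin m → κ) : ℝ :=
  𝔼 z, ∏ j, probVec (p z) (x j)

theorem sum_prod_probVec (p : PMF κ) (m : ℕ) : ∑ x : Fin m → κ, ∏ j, probVec p (x j) = 1 := by
  rw [← Fintype.sum_pow, sum_probVec, one_pow]

theorem sum_iidMixture_mul (p : Z → PMF κ) (f : (Fin m → κ) → ℝ) :
    ∑ x, iidMixture p m x * f x = 𝔼 z, ∑ x, (∏ j, probVec (p z) (x j)) * f x := by
  simp only [iidMixture, Finset.expect_mul, ← Finset.expect_sum_comm]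

theorem sum_iidMixture_sq_div (p : Z → PMF κ) (q : κ → ℝ) :
    ∑ x, iidMixture p m x ^ 2 / ∏ j, q (x j) =
      𝔼 z, 𝔼 z', (∑ i, probVec (p z) i * probVec (p z') i / q i) ^ m := by
  simp only [iidMixture, sq, Fintype.sum_pow, Finset.prod_div_distrib, Finset.prod_mul_distrib,
    Finset.expect_mul_expect, Finset.expect_div, ← Finset.expect_sum_comm]

theorem SampleAlg.exists_prob_le [Nonempty Z] {n : ℕ} {O : Type} (A : SampleAlg n O) (o : O)
    {q : PMF (Fin n)} (hq : ∀ i, 0 < probVec q i) (p : Z → PMF (Fin n)) {γ : ℝ} (hγ : 0 ≤ γ)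
    (hmoment : 𝔼 z, 𝔼 z', (∑ i, probVec (p z) i * probVec (p z') i / probVec q i) ^ A.samples ≤
      1 + γ ^ 2) :
    ∃ z, A.prob q o ≤ A.prob (p z) o + γ := by
  have hMsum : ∑ x, iidMixture p A.samples x = 1 := by
    simpa [sum_prod_probVec] using sum_iidMixture_mul p fun _ : Fin A.samples → Fin n => (1 : ℝ)
  have hsq : (A.prob q o - 𝔼 z, A.prob (p z) o) ^ 2 ≤ γ ^ 2 :=
    calc (A.prob q o - 𝔼 z, A.prob (p z) o) ^ 2
        = (∑ x, (∏ j, probVec q (x j)) * probVec (A.out x) o -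
            ∑ x, iidMixture p A.samples x * probVec (A.out x) o) ^ 2 := by
          rw [sum_iidMixture_mul]
          rfl
      _ ≤ ∑ x, iidMixture p A.samples x ^ 2 / ∏ j, probVec q (x j) - 1 :=
          sq_sum_sub_sum_le_chiSq (fun x => Finset.prod_pos fun j _ => hq (x j))
            (sum_prod_probVec q _) hMsum (fun x => probVec_nonneg _ _)
            fun x => probVec_le_one _ _
      _ ≤ γ ^ 2 := by
          rw [sum_iidMixture_sq_div]
          linarith
  have hmean : A.prob q o - γ ≤ 𝔼 z, A.prob (p z) o := by
    linarith [le_of_abs_le (abs_le_of_sq_le_sq hsq hγ)]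
  obtain ⟨z, -, hz⟩ := Finset.exists_le_of_le_expect Finset.univ_nonempty hmean
  exact ⟨z, by linarith⟩

end SecondMomentMethod

section Perturbations

theorem probVec_injective {κ : Type*} : Function.Injective (probVec : PMF κ → κ → ℝ) :=
  fun p q h => PMF.ext fun i =>
    (ENNReal.toReal_eq_toReal_iff' (p.apply_ne_top i) (q.apply_ne_top i)).1 (congrFun h i)

/-- A direction in which the uniform distribution over `[n]` can be moved: a relative change of the
masses that keeps them nonnegative and their sum unchanged. -/
structure Perturbation (n : ℕ) where
  dir : Fin n → ℝ
  neg_one_le_dir : ∀ i, -1 ≤ dir i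
  sum_dir : ∑ i, dir i = 0

namespace Perturbation

variable {n : ℕ} [NeZero n] (v : Perturbation n)

/-- The uniform distribution over `[n]` moved in the direction `v` by the step `s`. -/
def dist (s : unitInterval) : PMF (Fin n) :=
  ofProbVec (fun i => (1 + s * v.dir i) / n)
    (fun i => by
      have := mul_le_mul_of_nonneg_left (v.neg_one_le_dir i) s.2.1
      have := s.2.2
      exact div_nonneg (by linarith) n.cast_nonneg) <| by
    rw [← Finset.sum_div, Finset.sum_add_distrib, ← Finset.mul_sum, v.sum_dir]
    simp [NeZero.ne n]

theorem probVec_dist (s : unitInterval) (i : Fin n) :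
    probVec (v.dist s) i = (1 + s * v.dir i) / n :=
  congrFun (probVec_ofProbVec _ _) i

@[simp]
theorem dist_zero : v.dist 0 = PMF.uniformOfFintype (Fin n) :=
  probVec_injective <| funext fun i => by
    rw [probVec_dist, probVec_uniformOfFintype]
    simp

/-- The total variation distance from the uniform distribution that is reached with step `1`. -/
def radius : ℝ := (∑ i, |v.dir i|) / (2 * n)

theorem tv_dist_dist (s t : unitInterval) :
    tv (v.dist s) (v.dist t) = |(s : ℝ) - t| * v.radius := by
  have h (i : Fin n) : |probVec (v.dist s) i - probVec (v.dist t) i| =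
      |(s : ℝ) - t| / n * |v.dir i| := by
    rw [probVec_dist, probVec_dist, div_mul_eq_mul_div, ← abs_mul, ← Nat.abs_cast n, ← abs_div,
      Nat.abs_cast]
    ring_nf
  rw [tv_eq_half_l1, radius, Finset.sum_congr rfl fun i _ => h i, ← Finset.mul_sum]
  ring

theorem tv_dist_uniform (s : unitInterval) :
    tv (v.dist s) (PMF.uniformOfFintype (Fin n)) = s * v.radius := by
  rw [← v.dist_zero, tv_dist_dist, Set.Icc.coe_zero, sub_zero, abs_of_nonneg s.2.1]

theorem tv_uniform_dist (s : unitInterval) :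
    tv (PMF.uniformOfFintype (Fin n)) (v.dist s) = s * v.radius := by
  rw [← v.dist_zero, tv_dist_dist, Set.Icc.coe_zero, zero_sub, abs_neg, abs_of_nonneg s.2.1]

theorem sum_probVec_dist_mul_div (w : Perturbation n) (s : unitInterval) :
    ∑ i, probVec (v.dist s) i * probVec (w.dist s) i / probVec (PMF.uniformOfFintype (Fin n)) i =
      1 + s ^ 2 / n * ∑ i, v.dir i * w.dir i := by
  have hn : (n : ℝ) ≠ 0 := NeZero.ne _
  have h (i : Fin n) : probVec (v.dist s) i * probVec (w.dist s) i /
      probVec (PMF.uniformOfFintype (Fin n)) i =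
        1 / n + s / n * v.dir i + s / n * w.dir i + s ^ 2 / n * (v.dir i * w.dir i) := by
    rw [probVec_dist, probVec_dist, probVec_uniformOfFintype, Fintype.card_fin]
    field_simp
    ring
  simp only [h, Finset.sum_add_distrib, ← Finset.mul_sum, v.sum_dir, w.sum_dir]
  simp [hn]

end Perturbation

theorem SampleAlg.exists_prob_uniform_le {n : ℕ} [NeZero n] {O : Type} (A : SampleAlg n O) (o : O)
    {Z : Type*} [Fintype Z] [Nonempty Z] (v : Z → Perturbation n) (s : unitInterval) {γ : ℝ}
    (hγ : 0 ≤ γ)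
    (hmoment : 𝔼 z, 𝔼 z', Real.exp
      (A.samples * s ^ 2 / n * ∑ i, (v z).dir i * (v z').dir i) ≤ 1 + γ ^ 2) :
    ∃ z, A.prob (PMF.uniformOfFintype (Fin n)) o ≤ A.prob ((v z).dist s) o + γ := by
  have hU (i : Fin n) : 0 < probVec (PMF.uniformOfFintype (Fin n)) i := by
    rw [probVec_uniformOfFintype]
    exact one_div_pos.2 (Nat.cast_pos.2 Fintype.card_pos)
  refine A.exists_prob_le o hU _ hγ <| hmoment.trans' <|
    Finset.expect_le_expect fun z _ => Finset.expect_le_expect fun z' _ => ?_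
  have hnonneg := Finset.sum_nonneg (s := Finset.univ) fun i _ => div_nonneg
    (mul_nonneg (probVec_nonneg ((v z).dist s) i) (probVec_nonneg ((v z').dist s) i)) (hU i).le
  rw [Perturbation.sum_probVec_dist_mul_div] at hnonneg ⊢
  calc _ ≤ Real.exp (s ^ 2 / n * ∑ i, (v z).dir i * (v z').dir i) ^ A.samples :=
        pow_le_pow_left₀ hnonneg ((add_comm _ _).trans_le (Real.add_one_le_exp _)) _
    _ = _ := by
        rw [← Real.exp_nat_mul]
        ring_nf

theorem exp_le_one_add_two_mul {y : ℝ} (h0 : 0 ≤ y) (h1 : y ≤ 1) : Real.exp y ≤ 1 + 2 * y := by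
  have := (abs_le.1 (Real.abs_exp_sub_one_sub_id_le (abs_le.2 ⟨by linarith, h1⟩))).2
  nlinarith

end Perturbations

section HalfPerturbation

variable {n : ℕ}

theorem sum_ite_val_lt {k : ℕ} (hk : k ≤ n) (a b : ℝ) :
    ∑ i : Fin n, (if (i : ℕ) < k then a else b) = k * a + ((n : ℝ) - k) * b := by
  rw [Finset.sum_ite, Finset.sum_const, Finset.sum_const, Finset.filter_not,
    Finset.card_sdiff_of_subset (Finset.filter_subset _ _), Fin.card_filter_val_lt, min_eq_right hk,
    Finset.card_univ, Fintype.card_fin, nsmul_eq_mul, nsmul_eq_mul, Nat.cast_sub hk]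

theorem half_bounds (hn : 2 ≤ n) :
    0 < ((n / 2 : ℕ) : ℝ) ∧ 2 * ((n / 2 : ℕ) : ℝ) ≤ n ∧ (n : ℝ) ≤ 3 * (n / 2 : ℕ) :=
  ⟨by exact_mod_cast (by omega : 0 < n / 2), by exact_mod_cast (by omega : 2 * (n / 2) ≤ n),
    by exact_mod_cast (by omega : n ≤ 3 * (n / 2))⟩

/-- The perturbation that raises the masses of the first `⌊n / 2⌋` elements and lowers the others,
scaled so that its radius is `1 / 2`. -/
def halfPerturbation (hn : 2 ≤ n) : Perturbation n where
  dir i := if (i : ℕ) < n / 2 then n / (2 * (n / 2 : ℕ)) else -(n / (2 * (n - (n / 2 : ℕ))))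
  neg_one_le_dir i := by
    obtain ⟨h0, h2, -⟩ := half_bounds hn
    split_ifs
    · exact neg_one_lt_zero.le.trans (by positivity)
    · rw [neg_le_neg_iff, div_le_one (by linarith)]
      linarith
  sum_dir := by
    obtain ⟨h0, h2, -⟩ := half_bounds hn
    have h : (n : ℝ) - (n / 2 : ℕ) ≠ 0 := by linarith
    rw [sum_ite_val_lt (Nat.div_le_self n 2)]
    field_simp
    ring

theorem radius_halfPerturbation (hn : 2 ≤ n) : (halfPerturbation hn).radius = 1 / 2 := by
  obtain ⟨h0, h2, -⟩ := half_bounds hn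
  have h : 0 < (n : ℝ) - (n / 2 : ℕ) := by linarith
  have habs (i : Fin n) : |(halfPerturbation hn).dir i| =
      if (i : ℕ) < n / 2 then n / (2 * ((n / 2 : ℕ) : ℝ)) else n / (2 * (n - (n / 2 : ℕ))) := by
    simp only [halfPerturbation]
    split_ifs
    · exact abs_of_nonneg (by positivity)
    · rw [abs_neg, abs_of_nonneg (by positivity)]
  rw [Perturbation.radius, Finset.sum_congr rfl fun i _ => habs i,
    sum_ite_val_lt (Nat.div_le_self n 2)]
  field_simp
  norm_num

theorem sum_halfPerturbation_sq_le (hn : 2 ≤ n) :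
    ∑ i, (halfPerturbation hn).dir i * (halfPerturbation hn).dir i ≤ 5 / 4 * n := by
  obtain ⟨h0, h2, h3⟩ := half_bounds hn
  have h : 0 < (n : ℝ) - (n / 2 : ℕ) := by linarith
  have hsq (i : Fin n) : (halfPerturbation hn).dir i * (halfPerturbation hn).dir i =
      if (i : ℕ) < n / 2 then (n / (2 * ((n / 2 : ℕ) : ℝ))) ^ 2
      else (n / (2 * ((n : ℝ) - (n / 2 : ℕ)))) ^ 2 := by
    simp only [halfPerturbation]
    split_ifs <;> ring
  rw [Finset.sum_congr rfl fun i _ => hsq i, sum_ite_val_lt (Nat.div_le_self n 2)]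
  generalize ((n / 2 : ℕ) : ℝ) = k at *
  have hnk := h.ne'
  have hk : (n : ℝ) ^ 2 ≤ 5 * (k * (n - k)) := by
    linarith [mul_nonneg (sub_nonneg.2 h3) (sub_nonneg.2 h2), sq_nonneg k]
  calc k * (n / (2 * k)) ^ 2 + (n - k) * (n / (2 * (n - k))) ^ 2
      = n * (n ^ 2 / (4 * (k * (n - k)))) := by
        field_simp
        ring
    _ ≤ (n : ℝ) * (5 / 4) := by
        refine mul_le_mul_of_nonneg_left ?_ n.cast_nonneg
        rw [div_le_iff₀ (mul_pos four_pos (mul_pos h0 h))]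
        linarith
    _ = 5 / 4 * (n : ℝ) := mul_comm _ _

theorem SampleAlg.prob_uniform_le_prob_half [NeZero n] (hn : 2 ≤ n) {O : Type} (A : SampleAlg n O)
    (o : O) {s : unitInterval} {γ : ℝ} (hγ0 : 0 ≤ γ) (hγ1 : γ ≤ 1)
    (hs : 5 / 2 * (A.samples * (s : ℝ) ^ 2) ≤ γ ^ 2) :
    A.prob (PMF.uniformOfFintype (Fin n)) o ≤ A.prob ((halfPerturbation hn).dist s) o + γ := by
  have hγ2 : γ ^ 2 ≤ 1 := pow_le_one₀ hγ0 hγ1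
  have hexponent : A.samples * (s : ℝ) ^ 2 / n *
      ∑ i, (halfPerturbation hn).dir i * (halfPerturbation hn).dir i ≤ γ ^ 2 / 2 :=
    calc _ ≤ A.samples * (s : ℝ) ^ 2 / n * (5 / 4 * n) := by
          gcongr
          exact sum_halfPerturbation_sq_le hn
      _ = 5 / 4 * (A.samples * (s : ℝ) ^ 2) := by field_simp
      _ ≤ γ ^ 2 / 2 := by linarith
  obtain ⟨-, h⟩ := A.exists_prob_uniform_le o (fun _ : Unit => halfPerturbation hn) s hγ0 <| by
    simp only [Finset.expect_const Finset.univ_nonempty]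
    linarith [Real.exp_le_exp.2 hexponent,
      exp_le_one_add_two_mul (y := γ ^ 2 / 2) (by positivity) (by linarith)]
  exact h

end HalfPerturbation

section BlockPerturbation

variable {n : ℕ}

/-- The element with index `c` in block `b`, where `⌊n / 4⌋` blocks of four consecutive elements
are cut from `[n]`. -/
def blockElt (n : ℕ) (x : Fin (n / 4) × Fin 4) : Fin n := ⟨4 * x.1 + x.2, by omega⟩

theorem blockElt_injective (n : ℕ) : Function.Injective (blockElt n) := by
  rintro ⟨b, c⟩ ⟨b', c'⟩ h
  simp only [blockElt, Fin.mk.injEq] at h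
  ext <;> simp only <;> omega

/-- The perturbation of the uniform distribution on a block that moves all the mass to `a`. -/
def spike (a c : Fin 4) : ℝ := if a = c then 3 else -1

theorem neg_one_le_spike (a c : Fin 4) : -1 ≤ spike a c := by
  unfold spike
  split_ifs <;> norm_num

theorem sum_spike (a : Fin 4) : ∑ c, spike a c = 0 := by
  fin_cases a <;> simp [spike, Fin.sum_univ_four] <;> norm_num

theorem sum_abs_spike (a : Fin 4) : ∑ c, |spike a c| = 6 := by
  fin_cases a <;> simp [spike, Fin.sum_univ_four] <;> norm_num

theorem sum_spike_mul_spike (a a' : Fin 4) :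
    ∑ c, spike a c * spike a' c = if a = a' then 12 else -4 := by
  fin_cases a <;> fin_cases a' <;> simp [spike, Fin.sum_univ_four] <;> norm_num

/-- The direction of the perturbation that concentrates the mass of each block `b` on `z b`. -/
def blockDir (z : Fin (n / 4) → Fin 4) : Fin n → ℝ :=
  Function.extend (blockElt n) (fun x => spike (z x.1) x.2) 0

theorem blockDir_blockElt (z : Fin (n / 4) → Fin 4) (x : Fin (n / 4) × Fin 4) :
    blockDir z (blockElt n x) = spike (z x.1) x.2 :=
  (blockElt_injective n).extend_apply _ _ _

theorem blockDir_of_notMem_range (z : Fin (n / 4) → Fin 4) {i : Fin n}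
    (h : i ∉ Set.range (blockElt n)) : blockDir z i = 0 :=
  Function.extend_apply' _ _ _ h

theorem sum_blockDir₂ (z z' : Fin (n / 4) → Fin 4) {G : ℝ → ℝ → ℝ} (hG : G 0 0 = 0) :
    ∑ i, G (blockDir z i) (blockDir z' i) = ∑ b, ∑ c, G (spike (z b) c) (spike (z' b) c) := by
  rw [← Fintype.sum_prod_type']
  exact (Fintype.sum_of_injective (blockElt n) (blockElt_injective n) _ _
    (fun i hi => by rw [blockDir_of_notMem_range z hi, blockDir_of_notMem_range z' hi, hG])
    fun x => by rw [blockDir_blockElt, blockDir_blockElt]).symm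

/-- The perturbation that concentrates the mass of each block `b` on its element `z b`. -/
def blockPerturbation (z : Fin (n / 4) → Fin 4) : Perturbation n where
  dir := blockDir z
  neg_one_le_dir i := by
    by_cases h : i ∈ Set.range (blockElt n)
    · obtain ⟨x, rfl⟩ := h
      exact (neg_one_le_spike _ _).trans_eq (blockDir_blockElt z x).symm
    · exact neg_one_lt_zero.le.trans_eq (blockDir_of_notMem_range z h).symm
  sum_dir := (sum_blockDir₂ z z (G := fun x _ => x) rfl).trans <| by simp [sum_spike]

theorem radius_blockPerturbation (z : Fin (n / 4) → Fin 4) :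
    (blockPerturbation z).radius = 3 * (n / 4 : ℕ) / n := by
  have h : ∑ i, |(blockPerturbation z).dir i| = 6 * (n / 4 : ℕ) :=
    (sum_blockDir₂ z z (G := fun x _ => |x|) abs_zero).trans <| by
      simp [sum_abs_spike, mul_comm]
  rw [Perturbation.radius, h]
  ring

theorem sum_blockPerturbation_mul (z z' : Fin (n / 4) → Fin 4) :
    ∑ i, (blockPerturbation z).dir i * (blockPerturbation z').dir i =
      ∑ b, if z b = z' b then 12 else -4 :=
  (sum_blockDir₂ z z' (G := (· * ·)) (zero_mul 0)).trans <| by simp only [sum_spike_mul_spike]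

theorem expect_exp_agreement {k : ℕ} (t : ℝ) (z : Fin k → Fin 4) :
    𝔼 z' : Fin k → Fin 4, Real.exp (t * ∑ b, if z b = z' b then 12 else -4) =
      ((Real.exp (12 * t) + 3 * Real.exp (-4 * t)) / 4) ^ k := by
  have hblock (a : Fin 4) : ∑ c, Real.exp (t * if a = c then 12 else -4) =
      Real.exp (12 * t) + 3 * Real.exp (-4 * t) := by
    fin_cases a <;> simp [Fin.sum_univ_four] <;> ring_nf
  simp only [Fintype.expect_eq_sum_div_card, Finset.mul_sum, Real.exp_sum]
  rw [← Fintype.prod_sum fun b c => Real.exp (t * if z b = c then 12 else -4)]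
  simp only [hblock, Finset.prod_const, Finset.card_univ, Fintype.card_fin, Fintype.card_fun,
    Nat.cast_pow, Nat.cast_ofNat, div_pow]

theorem exp_add_three_mul_exp_le {t : ℝ} (h0 : 0 ≤ t) (h1 : t ≤ 1 / 12) :
    (Real.exp (12 * t) + 3 * Real.exp (-4 * t)) / 4 ≤ Real.exp (48 * t ^ 2) := by
  have h12 := (abs_le.1 (Real.abs_exp_sub_one_sub_id_le (x := 12 * t)
    (abs_le.2 ⟨by linarith, by linarith⟩))).2
  have h4 := (abs_le.1 (Real.abs_exp_sub_one_sub_id_le (x := -4 * t)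
    (abs_le.2 ⟨by linarith, by linarith⟩))).2
  linarith [Real.add_one_le_exp (48 * t ^ 2)]

theorem expect_exp_blockPerturbation_le {t : ℝ} (h0 : 0 ≤ t) (h1 : t ≤ 1 / 12) :
    𝔼 z : Fin (n / 4) → Fin 4, 𝔼 z', Real.exp
      (t * ∑ i, (blockPerturbation z).dir i * (blockPerturbation z').dir i) ≤
        Real.exp (12 * (t ^ 2 * n)) := by
  have hk : ((n / 4 : ℕ) : ℝ) ≤ n / 4 := Nat.cast_div_le
  simp only [sum_blockPerturbation_mul, expect_exp_agreement,
    Finset.expect_const Finset.univ_nonempty]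
  calc _ ≤ Real.exp (48 * t ^ 2) ^ (n / 4) := by
        gcongr
        exact exp_add_three_mul_exp_le h0 h1
    _ = Real.exp ((n / 4 : ℕ) * (48 * t ^ 2)) := (Real.exp_nat_mul _ _).symm
    _ ≤ Real.exp (12 * (t ^ 2 * n)) := by
        rw [Real.exp_le_exp]
        linarith [mul_le_mul_of_nonneg_right hk (by positivity : 0 ≤ 48 * t ^ 2)]

theorem SampleAlg.exists_prob_uniform_le_prob_block [NeZero n] {O : Type} (A : SampleAlg n O)
    (o : O) {s : unitInterval} {γ : ℝ} (hγ0 : 0 ≤ γ) (hγ1 : γ ≤ 1)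
    (hs : 40 * (A.samples * (s : ℝ) ^ 2) ≤ γ ^ 2 * √(n : ℝ)) :
    ∃ z, A.prob (PMF.uniformOfFintype (Fin n)) o ≤ A.prob ((blockPerturbation z).dist s) o + γ := by
  have hn0 : (0 : ℝ) < n := Nat.cast_pos.2 (NeZero.pos n)
  have hr1 : 1 ≤ √(n : ℝ) := Real.one_le_sqrt.2 (by exact_mod_cast NeZero.one_le (n := n))
  have hγ2 : γ ^ 2 ≤ 1 := pow_le_one₀ hγ0 hγ1
  set t : ℝ := A.samples * (s : ℝ) ^ 2 / n with ht
  have ht0 : 0 ≤ t := by positivity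
  have htr : t * √(n : ℝ) ≤ γ ^ 2 / 40 := by
    rw [ht, div_mul_eq_mul_div, div_le_iff₀ hn0]
    have := mul_le_mul_of_nonneg_right hs (Real.sqrt_nonneg n)
    rw [mul_assoc (γ ^ 2), Real.mul_self_sqrt hn0.le] at this
    linarith
  have ht1 : t ≤ 1 / 12 := by linarith [le_mul_of_one_le_right ht0 hr1]
  have htn : 12 * (t ^ 2 * n) ≤ γ ^ 2 / 2 :=
    calc 12 * (t ^ 2 * n) = 12 * (t * √(n : ℝ)) ^ 2 := by rw [mul_pow, Real.sq_sqrt hn0.le]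
      _ ≤ 12 * (γ ^ 2 / 40) ^ 2 := by gcongr
      _ ≤ γ ^ 2 / 2 := by nlinarith [sq_nonneg γ]
  refine A.exists_prob_uniform_le o blockPerturbation s hγ0 <|
    (expect_exp_blockPerturbation_le ht0 ht1).trans ?_
  linarith [Real.exp_le_exp.2 htn,
    exp_le_one_add_two_mul (y := γ ^ 2 / 2) (by positivity) (by linarith)]

end BlockPerturbation

section LowerBound

variable {n : ℕ} {O : Type}

theorem SampleAlg.prob_eq_prob_of_samples_eq_zero {A : SampleAlg n O} (hA : A.samples = 0)
    (p q : PMF (Fin n)) (o : O) : A.prob p o = A.prob q o := by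
  have : IsEmpty (Fin A.samples) := hA ▸ Fin.isEmpty
  simp only [SampleAlg.prob, Finset.univ_eq_empty, Finset.prod_empty]

theorem le_tv_pure_uniform [NeZero n] (i : Fin n) :
    1 - 1 / (n : ℝ) ≤ tv (PMF.pure i) (PMF.uniformOfFintype (Fin n)) :=
  calc 1 - 1 / (n : ℝ)
      ≤ |mass (PMF.pure i) {i} - mass (PMF.uniformOfFintype (Fin n)) {i}| := by
        simpa [mass] using le_abs_self (1 - (n : ℝ)⁻¹)
    _ ≤ _ := abs_mass_sub_le_tv _ _ _

theorem two_le_of_lt_one_sub_inv [NeZero n] {ε : ℝ} (hε : 0 ≤ ε) (hεn : ε < 1 - 1 / (n : ℝ)) :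
    2 ≤ n := by
  have h : 1 / (n : ℝ) < 1 := by linarith
  rw [div_lt_one (Nat.cast_pos.2 (NeZero.pos n))] at h
  exact_mod_cast h

theorem SampleAlg.exists_far_of_twelve_le [NeZero n] (hn : 12 ≤ n) (A : SampleAlg n O) (o : O)
    {ε γ : ℝ} (hε : 0 < ε) (hε1 : ε ≤ 1 / 2) (hγ0 : 0 ≤ γ) (hγ1 : γ ≤ 1)
    (hm : 160 * (A.samples * ε ^ 2) ≤ γ ^ 2 * √(n : ℝ)) :
    ∃ p, ε < tv p (PMF.uniformOfFintype (Fin n)) ∧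
      A.prob (PMF.uniformOfFintype (Fin n)) o ≤ A.prob p o + γ := by
  obtain ⟨z, hz⟩ := A.exists_prob_uniform_le_prob_block o
    (s := ⟨2 * ε, by linarith, by linarith⟩) hγ0 hγ1 (by linarith)
  refine ⟨_, ?_, hz⟩
  have hn0 : (0 : ℝ) < n := Nat.cast_pos.2 (NeZero.pos n)
  have hblocks : (n : ℝ) ≤ 5 * (n / 4 : ℕ) := by exact_mod_cast (by omega : n ≤ 5 * (n / 4))
  rw [Perturbation.tv_dist_uniform, radius_blockPerturbation, ← mul_div_assoc, lt_div_iff₀ hn0]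
  linarith [mul_le_mul_of_nonneg_left hblocks hε.le, mul_pos hε hn0]

theorem SampleAlg.exists_far_of_le_sixteen [NeZero n] (hn : n ≤ 16) (A : SampleAlg n O) (o : O)
    {ε γ : ℝ} (hε : 0 < ε) (hεn : ε < 1 - 1 / (n : ℝ)) (hγ0 : 0 ≤ γ) (hγ1 : γ ≤ 1)
    (hm : 160 * (A.samples * ε ^ 2) ≤ γ ^ 2 * √(n : ℝ)) :
    ∃ p, ε < tv p (PMF.uniformOfFintype (Fin n)) ∧
      A.prob (PMF.uniformOfFintype (Fin n)) o ≤ A.prob p o + γ := by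
  rcases Nat.eq_zero_or_pos A.samples with hA | hA
  · exact ⟨PMF.pure 0, hεn.trans_le (le_tv_pure_uniform 0),
      (SampleAlg.prob_eq_prob_of_samples_eq_zero hA _ _ o).trans_le (le_add_of_nonneg_right hγ0)⟩
  · have hsqrt : √(n : ℝ) ≤ 4 := Real.sqrt_le_iff.2 ⟨by norm_num, by norm_num; exact_mod_cast hn⟩
    have hm4 : 40 * (A.samples * ε ^ 2) ≤ γ ^ 2 := by
      linarith [mul_le_mul_of_nonneg_left hsqrt (sq_nonneg γ)]
    have hε4 : 4 * ε ≤ 1 := by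
      have hA1 : (1 : ℝ) ≤ A.samples := by exact_mod_cast hA
      have := le_mul_of_one_le_left (sq_nonneg ε) hA1
      nlinarith [pow_le_one₀ (n := 2) hγ0 hγ1]
    refine ⟨_, ?_, A.prob_uniform_le_prob_half (two_le_of_lt_one_sub_inv hε.le hεn) o
      (s := ⟨4 * ε, by linarith, hε4⟩) hγ0 hγ1 (by linarith)⟩
    rw [Perturbation.tv_dist_uniform, radius_halfPerturbation]
    linarith

theorem SampleAlg.exists_far_of_pos [NeZero n] (A : SampleAlg n O) (o : O) {ε γ : ℝ}
    (hε : 0 < ε) (hε1 : ε ≤ 1 / 2) (hεn : ε < 1 - 1 / (n : ℝ)) (hγ0 : 0 ≤ γ) (hγ1 : γ ≤ 1)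
    (hm : 160 * (A.samples * ε ^ 2) ≤ γ ^ 2 * √(n : ℝ)) :
    ∃ p, ε < tv p (PMF.uniformOfFintype (Fin n)) ∧
      A.prob (PMF.uniformOfFintype (Fin n)) o ≤ A.prob p o + γ :=
  (le_total 12 n).elim (A.exists_far_of_twelve_le · o hε hε1 hγ0 hγ1 hm)
    fun hn => A.exists_far_of_le_sixteen (by omega) o hε hεn hγ0 hγ1 hm

theorem SampleAlg.exists_far [NeZero n] (A : SampleAlg n O) (o : O) {ε γ : ℝ}
    (hε : 0 ≤ ε) (hε1 : ε ≤ 1 / 2) (hεn : ε < 1 - 1 / (n : ℝ)) (hγ0 : 0 ≤ γ) (hγ1 : γ ≤ 1)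
    (hm : 160 * (A.samples * ε ^ 2) < γ ^ 2 * √(n : ℝ)) :
    ∃ p, ε < tv p (PMF.uniformOfFintype (Fin n)) ∧
      A.prob (PMF.uniformOfFintype (Fin n)) o ≤ A.prob p o + γ := by
  rcases hε.eq_or_lt with rfl | hε
  · have hid : Filter.Tendsto (fun x : ℝ => x) (nhdsWithin 0 (Set.Ioi 0)) (nhds 0) :=
      nhdsWithin_le_nhds
    have hsmall : ∀ᶠ x : ℝ in nhdsWithin 0 (Set.Ioi 0),
        160 * (A.samples * x ^ 2) < γ ^ 2 * √(n : ℝ) :=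
      (((hid.pow 2).const_mul _).const_mul 160).eventually_lt_const hm
    obtain ⟨ε, hmε, hε1, hεn, hε⟩ := (hsmall.and <| (hid.eventually_lt_const one_half_pos).and <|
      (hid.eventually_lt_const hεn).and self_mem_nhdsWithin).exists
    obtain ⟨p, hp, hprob⟩ := A.exists_far_of_pos o hε hε1.le hεn hγ0 hγ1 hmε.le
    exact ⟨p, (Set.mem_Ioi.1 hε).trans hp, hprob⟩
  · exact A.exists_far_of_pos o hε hε1 hεn hγ0 hγ1 hm.le

theorem SampleAlg.sum_prob [Fintype O] (A : SampleAlg n O) (p : PMF (Fin n)) :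
    ∑ o, A.prob p o = 1 :=
  calc ∑ o, A.prob p o
      = ∑ x, (∏ j, probVec p (x j)) * ∑ o, probVec (A.out x) o := by
        simp only [Finset.mul_sum]
        exact Finset.sum_comm
    _ = 1 := by simp only [sum_probVec, mul_one, sum_prod_probVec]

theorem SampleAlg.prob_accept_add_reject_add_inaccurate (A : SampleAlg n Answer)
    (p : PMF (Fin n)) : A.prob p .accept + A.prob p .reject + A.prob p .inaccurate = 1 := by
  classical
  let _ : Fintype Answer := ⟨{.accept, .reject, .inaccurate}, by rintro (_ | _ | _) <;> simp⟩
  rw [← A.sum_prob p]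
  change _ = ∑ o ∈ ({.accept, .reject, .inaccurate} : Finset Answer), _
  rw [Finset.sum_insert (by simp), Finset.sum_pair (by simp), add_assoc]

theorem IsAugmentedFor.one_le_of_prob_le {α ε δ γ : ℝ} {q phat p p' : PMF (Fin n)}
    {A : SampleAlg n Answer} (hA : IsAugmentedFor α ε δ q phat A) (hp : tv p phat ≤ α)
    (hp' : ε < tv p' q) (hinaccurate : A.prob q .inaccurate ≤ A.prob p .inaccurate + γ)
    (haccept : A.prob q .accept ≤ A.prob p' .accept + γ) : 1 ≤ 3 * δ / 2 + 2 * γ := by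
  linarith [A.prob_accept_add_reject_add_inaccurate q, (hA p).1 hp, (hA q).2.1 rfl,
    (hA p').2.2 hp']

theorem ofReal_mul_div_le_natCast {a b c : ℝ} {m : ℕ} (hc : 0 ≤ c) (h : c * a ≤ m * b) :
    ENNReal.ofReal c * (ENNReal.ofReal a / ENNReal.ofReal b) ≤ m := by
  rw [← mul_div_assoc, ← ENNReal.ofReal_mul hc]
  refine ENNReal.div_le_of_le_mul ?_
  rw [← ENNReal.ofReal_natCast, ← ENNReal.ofReal_mul m.cast_nonneg]
  exact ENNReal.ofReal_le_ofReal h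

theorem IsAugmentedFor.le_samples_of_tv_le [NeZero n] {α ε δ γ : ℝ} (hε : 0 ≤ ε)
    (hε1 : ε ≤ 1 / 2) (hεn : ε < 1 - 1 / (n : ℝ)) (hγ0 : 0 ≤ γ) (hγ1 : γ ≤ 1)
    (hδ : 3 * δ / 2 + 2 * γ < 1) {phat : PMF (Fin n)}
    (hphat : tv (PMF.uniformOfFintype (Fin n)) phat ≤ α) {A : SampleAlg n Answer}
    (hA : IsAugmentedFor α ε δ (PMF.uniformOfFintype (Fin n)) phat A) :
    ENNReal.ofReal (γ ^ 2 / 160) *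
      augmentedRate n α ε (tv (PMF.uniformOfFintype (Fin n)) phat) ≤ A.samples := by
  rw [augmentedRate_of_le hphat]
  refine ofReal_mul_div_le_natCast (by positivity) <| le_of_not_gt fun hm => hδ.not_ge ?_
  obtain ⟨p, hp, hprob⟩ := A.exists_far .accept hε hε1 hεn hγ0 hγ1 (by linarith)
  exact hA.one_le_of_prob_le hphat hp (le_add_of_nonneg_right hγ0) hprob

theorem exists_prediction_forall_le_samples [NeZero n] {α ε δ γ d : ℝ} (hα : 0 ≤ α) (hε : 0 ≤ ε)
    (hε1 : ε ≤ 1 / 2) (hεn : ε < 1 - 1 / (n : ℝ)) (hγ0 : 0 ≤ γ) (hγ1 : γ ≤ 1)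
    (hδ : 3 * δ / 2 + 2 * γ < 1) (hd : α < d) (hd1 : d ≤ 1 / 2) :
    ∃ phat : PMF (Fin n), tv (PMF.uniformOfFintype (Fin n)) phat = d ∧
      ∀ A, IsAugmentedFor α ε δ (PMF.uniformOfFintype (Fin n)) phat A →
        ENNReal.ofReal (γ ^ 2 / 160) * augmentedRate n α ε d ≤ A.samples := by
  have hn := two_le_of_lt_one_sub_inv hε hεn
  let v := halfPerturbation hn
  let s : unitInterval := ⟨2 * d, by linarith, by linarith⟩
  let t : unitInterval := ⟨2 * (d - α), by linarith, by linarith⟩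
  have htv : tv (v.dist t) (v.dist s) = α := by
    rw [v.tv_dist_dist, radius_halfPerturbation, abs_of_nonpos (by linarith)]
    ring
  refine ⟨v.dist s, ?_, fun A hA => ?_⟩
  · rw [v.tv_uniform_dist, radius_halfPerturbation]
    ring
  have hsamples : γ ^ 2 / 160 * 1 ≤ A.samples * (d - α) ^ 2 ∨
      γ ^ 2 / 160 * √(n : ℝ) ≤ A.samples * ε ^ 2 := by
    by_contra! hm
    obtain ⟨p, hp, hprob⟩ := A.exists_far .accept hε hε1 hεn hγ0 hγ1 (by linarith)
    have ht : 5 / 2 * (A.samples * (t : ℝ) ^ 2) ≤ γ ^ 2 := by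
      linarith [sq_nonneg γ]
    exact hδ.not_ge <| hA.one_le_of_prob_le htv.le hp
      (A.prob_uniform_le_prob_half hn .inaccurate hγ0 hγ1 ht) hprob
  rw [augmentedRate, if_neg hd.not_ge, ← ENNReal.ofReal_one, mul_min, min_le_iff]
  exact hsamples.imp (ofReal_mul_div_le_natCast (by positivity))
    (ofReal_mul_div_le_natCast (by positivity))

end LowerBound

end AugTest

end

theorem theorem4p1 :
    -- Standard testers with `O(√n / ε²)` samples, as called by the algorithm, exist.
    (∃ T : (n : ℕ) → ℝ → PMF (Fin n) → AugTest.SampleAlg n AugTest.Verdict, ∃ C : ℝ≥0,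
      ∀ (n : ℕ) (ε : ℝ), 0 < ε → ε ≤ 1 →
        AugTest.IsStandardIdentityTester ε (1 / 20) (T n ε) ∧
        ∀ q : PMF (Fin n), ((T n ε q).samples : ℝ≥0∞) ≤ C * AugTest.standardRate n ε) ∧
    -- Upper bound: with any such standard tester, and with any large enough constant `K` in the
    -- number of samples of the Scheffé-set branch, the algorithm is an `(α, ε, 0.1)`-augmented
    -- tester with the claimed number of samples.
    (∃ K₀ : ℝ, 0 < K₀ ∧ ∀ K : ℝ, K₀ ≤ K → ∀ C : ℝ≥0, ∃ C' : ℝ≥0,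
      ∀ T : (n : ℕ) → ℝ → PMF (Fin n) → AugTest.SampleAlg n AugTest.Verdict,
        (∀ (n : ℕ) (ε : ℝ), 0 < ε → ε ≤ 1 →
          AugTest.IsStandardIdentityTester ε (1 / 20) (T n ε) ∧
          ∀ q : PMF (Fin n), ((T n ε q).samples : ℝ≥0∞) ≤ C * AugTest.standardRate n ε) →
        ∀ (n : ℕ) (α ε : ℝ), 0 ≤ α → α ≤ 1 → 0 < ε → ε ≤ 1 →
          AugTest.IsAugmentedIdentityTester α ε (1 / 10)
            (AugTest.augmentedIdentityTester K (T n ε) α ε) ∧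
          ∀ q phat : PMF (Fin n),
            ((AugTest.augmentedIdentityTester K (T n ε) α ε q phat).samples : ℝ≥0∞) ≤
              C' * AugTest.augmentedRate n α ε (AugTest.tv q phat)) ∧
    -- Lower bound, already for uniform `q`, with a constant that depends only on `δ`.
    (∀ δ : ℝ, 0 < δ → δ < 2 / 3 → ∃ c : ℝ≥0, 0 < c ∧
      ∀ (n : ℕ) [NeZero n] (α ε : ℝ), 0 ≤ α → α ≤ 1 → 0 ≤ ε → ε ≤ 1 / 2 → ε < 1 - 1 / (n : ℝ) →
        -- The case `d ≤ α`, for every prediction.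
        (∀ phat : PMF (Fin n), AugTest.tv (PMF.uniformOfFintype (Fin n)) phat ≤ α →
          ∀ A : AugTest.SampleAlg n AugTest.Answer,
            AugTest.IsAugmentedFor α ε δ (PMF.uniformOfFintype (Fin n)) phat A →
            c * AugTest.augmentedRate n α ε (AugTest.tv (PMF.uniformOfFintype (Fin n)) phat) ≤
              (A.samples : ℝ≥0∞)) ∧
        -- The case `α < d`: for every value of `d` there is a prediction that is hard.
        (∀ d : ℝ, α < d → d ≤ 1 / 2 →
          ∃ phat : PMF (Fin n), AugTest.tv (PMF.uniformOfFintype (Fin n)) phat = d ∧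
            ∀ A : AugTest.SampleAlg n AugTest.Answer,
              AugTest.IsAugmentedFor α ε δ (PMF.uniformOfFintype (Fin n)) phat A →
              c * AugTest.augmentedRate n α ε d ≤ (A.samples : ℝ≥0∞))) := by
  refine ⟨⟨fun n ε => AugTest.pairTester (AugTest.batchSize n ε) ε, 802, fun n ε hε hε1 =>
      ⟨AugTest.pairTester_isStandardIdentityTester n hε hε1,
        AugTest.pairTester_samples_le hε hε1⟩⟩,
    ⟨80, by norm_num, fun K hK C => ⟨max C (K + 1).toNNReal, fun T hT n α ε hα _ hε hε1 =>
      ⟨AugTest.augmentedIdentityTester_isAugmentedIdentityTester hK (hT n ε hε hε1).1,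
        AugTest.augmentedIdentityTester_samples_le (by linarith) hα hε (hT n ε hε hε1).2⟩⟩⟩,
    fun δ hδ0 hδ => ?_⟩
  obtain ⟨γ, hγ0, hγ1, hγδ⟩ : ∃ γ : ℝ, 0 < γ ∧ γ ≤ 1 ∧ 3 * δ / 2 + 2 * γ < 1 :=
    ⟨(1 - 3 * δ / 2) / 4, by linarith, by linarith, by linarith⟩
  refine ⟨(γ ^ 2 / 160).toNNReal, Real.toNNReal_pos.2 (by positivity),
    fun n _ α ε hα _ hε hε1 hεn => ⟨fun phat hd A hA => ?_, fun d hd hd1 => ?_⟩⟩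
  · exact hA.le_samples_of_tv_le hε hε1 hεn hγ0.le hγ1 hγδ hd
  · exact AugTest.exists_prediction_forall_le_samples hα hε hε1 hεn hγ0.le hγ1 hγδ hd hd1
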